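/- Let $\mathbb{T}$ be the unit circle with normalized Lebesgue measure $\ell$, let $I\subset\mathbb{T}$ be Lebesgue measurable with $\ell(I)>0$, and assume that $J=\mathbb{T}\setminus I$ satisfies $\ell(J)>0$. Let $H^2$ be the closed subspace of $L^2(\mathbb{T})$ of those functions whose Fourier coefficients of strictly negative index vanish. For $f\in L^2(I)$, consider the problem of finding $g_0\in H^2$ with $|g_0|\le 1$ a.e. on $J$ such that $$\|f-g_0\|_{L^2(I)}=\min\bigl\{\|f-g\|_{L^2(I)}:\ g\in H^2,\ |g|\le 1\ \text{a.e. on } J\bigr\}.\qquad(\ast)$$ Let $f\in L^2(I)$, let $(f^{(n)})_{n\in\mathbb{N}}$ be a sequence converging to $f$ in $L^2(I)$, let $g_0$ be the solution of $(\ast)$ for $f$, and let $g_0^{(n)}$ be the solution of $(\ast)$ with $f^{(n)}$ in place of $f$. Then $g_0^{(n)}|_I\to g_0|_I$ in $L^2(I)$, and $g_0^{(n)}|_J\to g_0|_J$ weak-* in $L^\infty(J)=L^1(J)^*$. Suppose in addition that the boundary $\partial I$ of $I$ in $\mathbb{T}$ satisfies $\ell(\partial I)=0$, and that $f$ is not the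 trace on $I$ of a function $g\in H^2$ with $|g|\le 1$ a.e. on $J$ and $|g|<1$ on a subset of $J$ of positive measure. (This holds in particular if $f$ is not the trace on $I$ of any $g\in H^2$ with $|g|\le1$ a.e. on $J$.) Then $g_0^{(n)}\to g_0$ in $L^2(\mathbb{T})$. -/

import Mathlib

open MeasureTheory Filter Topology
open scoped ENNReal

namespace HardyBEP

noncomputable section

instance fact_two_pi_pos : Fact ((0 : ℝ) < 2 * Real.pi) := ⟨Real.two_pi_pos⟩

/-- The unit circle, a point `e^{iθ}` being represented by the class of `θ` modulo `2π`. -/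
abbrev UCircle : Type := AddCircle (2 * Real.pi)

/-- Normalized Lebesgue measure on the unit circle (total mass `1`). -/
abbrev ell : Measure UCircle := AddCircle.haarAddCircle

/-- `L²(E)`: classes of complex functions on `E`, square integrable for normalized Lebesgue
measure. -/
abbrev L2On (E : Set UCircle) : Type := Lp ℂ 2 (ell.restrict E)

/-- `L²` of the whole circle. -/
abbrev L2Circle : Type := Lp ℂ 2 ell

/-- The Hardy space `H²`: functions in `L²` of the circle all of whose Fourier coefficients of
strictly negative index vanish. -/
def hardyH2 : Submodule ℂ L2Circle where
  carrier := {g | ∀ n : ℤ, n < 0 → fourierCoeff (g : UCircle → ℂ) n = 0}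
  zero_mem' := by
    intro n _
    rw [fourierCoeff_congr_ae (Lp.coeFn_zero ℂ 2 ell)]
    simp [fourierCoeff]
  add_mem' := by
    intro a b ha hb n hn
    rw [fourierCoeff_congr_ae (Lp.coeFn_add a b),
      fourierCoeff.add ((Lp.memLp a).integrable (by norm_num))
        ((Lp.memLp b).integrable (by norm_num)), Pi.add_apply, ha n hn, hb n hn, add_zero]
  smul_mem' := by
    intro c a ha n hn
    rw [fourierCoeff_congr_ae (Lp.coeFn_smul c a), fourierCoeff.const_smul, ha n hn, smul_zero]

/-- Restriction `g ↦ g|_E` from `L²` of the circle to `L²(E)`. -/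
def restrictL2 (E : Set UCircle) : L2Circle →L[ℂ] L2On E :=
  LpToLpRestrictCLM UCircle ℂ ℂ ell 2 E

/-- The candidate approximants: `g ∈ H²` with `|g| ≤ 1` a.e. on `J = Iᶜ`. -/
def candidates (I : Set UCircle) : Set L2Circle :=
  {g | g ∈ hardyH2 ∧ ∀ᵐ x ∂(ell.restrict Iᶜ), ‖g x‖ ≤ 1}

/-- `g₀` solves the bounded extremal problem for the data `f ∈ L²(I)`: it is a candidate and
minimizes `‖f - g‖_{L²(I)}` over all candidates `g`. -/
def IsBEPSolution (I : Set UCircle) (f : L2On I) (g₀ : L2Circle) : Prop :=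
  g₀ ∈ candidates I ∧ IsMinOn (fun g : L2Circle => ‖f - restrictL2 I g‖) (candidates I) g₀

/-- Weak-* convergence `u n → v` in `L^∞(E)`, regarded as the dual of `L¹(E)`: all the functions
belong to `L^∞(E)`, and their integrals against every `φ ∈ L¹(E)` converge. -/
def WeakStarTendstoLinfty (E : Set UCircle) (u : ℕ → UCircle → ℂ) (v : UCircle → ℂ) : Prop :=
  (∀ n, MemLp (u n) ∞ (ell.restrict E)) ∧ MemLp v ∞ (ell.restrict E) ∧
    ∀ φ : UCircle → ℂ, IntegrableOn φ E ell →
      Tendsto (fun n => ∫ x in E, u n x * φ x ∂ell) atTop (𝓝 (∫ x in E, v x * φ x ∂ell))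

end

end HardyBEP

namespace HardyBEP

noncomputable section

open scoped ComplexConjugate InnerProductSpace

/-! On `L²(I)` the trace of a solution is a nearest point of a convex set, so a first-order
variational inequality makes it a 1-Lipschitz function of the data
(`IsBEPSolution.norm_restrictL2_sub_le`). This gives convergence on `I`. The differences `gseq n -
g₀` lie in `H²`, are bounded and tend to zero on `I`. The test functions against which they tend to
zero include the negative monomials and everything supported on `I`. What is orthogonal to all of
these is an `H²` function vanishing on `I`, hence zero. So convergence is weak in `L²` and, by the
bound on `J`, weak-* there.

For strong convergence it suffices that `|g₀| = 1` on `J`: then `gseq n` has norm at most that of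
`g₀` on `J`, and weak convergence becomes strong. Saturation is the core
(`IsBEPSolution.restrictL2_eq`). Suppose `|g₀| ≤ 1 - ε` on `E ⊆ J` with positive measure, and let
`D` be `f - g₀` on `I` and `0` on `J`. Then `g₀` maximizes `re ⟪D, ·⟫` over candidates. By
Hahn–Banach, `D` is an `L²` limit of `e n + q n`, with `e n` orthogonal to `H²` and `q n` carried by
`J` with `L¹` mass close to the maximum. Near-equality forces the mass of `q n` on `E` to vanish, so
`e n → 0` in `L¹(E)`, and then every Fourier coefficient of `e n` tends to zero
(`tendsto_inner_zpow_zero`). Only `L¹` bounds are available, so one tests against continuous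
functions supported in the closure of the interior of `I`, where `q n` is invisible: `D = 0` there.
As the boundary is null, `D = 0` and `g₀` interpolates `f`, which is excluded.

The facts needed on `H²` (uniqueness, functions of prescribed modulus) come from one observation:
the part of `g` orthogonal to all `z ^ n g`, `n ≥ 1`, has constant modulus
(`norm_sq_innovation_ae`). -/

/-! ### Uniqueness of Fourier coefficients in `L¹`. -/

/-- An integrable function with vanishing Fourier coefficients vanishes almost everywhere. -/
theorem ae_eq_zero_of_forall_integral_fourier_mul {w : UCircle → ℂ} (hw : Integrable w ell)
    (h : ∀ n : ℤ, ∫ x, fourier n x * w x ∂ell = 0) : w =ᵐ[ell] 0 := by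
  have hint : ∀ c : C(UCircle, ℂ), Integrable (fun x => c x * w x) ell := fun c =>
    hw.bdd_mul c.continuous.aestronglyMeasurable (ae_of_all _ c.norm_coe_le_norm)
  have hcont : ∀ c : C(UCircle, ℂ), ∫ x, c x * w x ∂ell = 0 := by
    intro c
    have hc : c ∈ (Submodule.span ℂ (Set.range (@fourier (2 * Real.pi)))).topologicalClosure := by
      rw [span_fourier_closure_eq_top]; trivial
    let Λ : C(UCircle, ℂ) →ₗ[ℂ] ℂ :=
      { toFun := fun c => ∫ x, c x * w x ∂ell
        map_add' := fun a b => by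
          simp only [ContinuousMap.add_apply, add_mul]
          exact integral_add (hint a) (hint b)
        map_smul' := fun a b => by
          simp only [ContinuousMap.smul_apply, smul_eq_mul, mul_assoc, RingHom.id_apply]
          exact integral_const_mul _ _ }
    let Λc : C(UCircle, ℂ) →L[ℂ] ℂ := Λ.mkContinuous (∫ x, ‖w x‖ ∂ell) (fun c => by
      calc ‖∫ x, c x * w x ∂ell‖ ≤ ∫ x, ‖c x * w x‖ ∂ell := norm_integral_le_integral_norm _
        _ ≤ ∫ x, ‖w x‖ * ‖c‖ ∂ell := by
          refine integral_mono (hint c).norm (hw.norm.mul_const _) fun x => ?_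
          simp only [norm_mul]
          rw [mul_comm]
          exact mul_le_mul_of_nonneg_left (c.norm_coe_le_norm x) (norm_nonneg _)
        _ = (∫ x, ‖w x‖ ∂ell) * ‖c‖ := integral_mul_const _ _)
    have hle : (Submodule.span ℂ (Set.range (@fourier (2 * Real.pi)))).topologicalClosure
        ≤ Λc.ker := by
      refine Submodule.topologicalClosure_minimal _ ?_ Λc.isClosed_ker
      rw [Submodule.span_le]
      rintro _ ⟨n, rfl⟩
      exact h n
    exact hle hc
  -- Indicators of closed sets are bounded pointwise limits of continuous functions.
  refine ae_eq_zero_of_forall_setIntegral_isClosed_eq_zero hw fun s hs => ?_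
  let a : ℕ → C(UCircle, ℂ) := fun n =>
    ⟨fun x => ((hs.apprSeq n x : NNReal) : ℂ), by fun_prop⟩
  have hlim : Tendsto (fun n => ∫ x, a n x * w x ∂ell) atTop
      (𝓝 (∫ x, s.indicator w x ∂ell)) := by
    refine tendsto_integral_of_dominated_convergence (fun x => ‖w x‖)
      (fun n => (hint (a n)).aestronglyMeasurable) hw.norm ?_ ?_
    · refine fun n => ae_of_all _ fun x => ?_
      rw [norm_mul]
      refine mul_le_of_le_one_left (norm_nonneg _) ?_
      have : hs.apprSeq n x ≤ 1 := HasOuterApproxClosed.apprSeq_apply_le_one hs n x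
      simpa [a] using this
    · refine ae_of_all _ fun x => ?_
      have h1 := tendsto_pi_nhds.1 (HasOuterApproxClosed.tendsto_apprSeq hs) x
      have h2 : Tendsto (fun n => a n x) atTop
          (𝓝 (((s.indicator (fun _ => (1 : NNReal)) x : NNReal) : ℝ) : ℂ)) :=
        (Complex.continuous_ofReal.tendsto _).comp
          ((NNReal.continuous_coe.tendsto _).comp h1)
      have h3 := h2.mul_const (w x)
      convert h3 using 2
      by_cases hx : x ∈ s <;> simp [hx]
  simp only [hcont, integral_indicator hs.measurableSet] at hlim
  exact (tendsto_nhds_unique hlim tendsto_const_nhds)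

/-! ### Multiplication operators, shifts and monomials. -/

/-- Multiplication by a bounded function on `L²` of the circle. -/
def mulCLM (b : UCircle → ℂ) (hb : MemLp b ∞ ell) : L2Circle →L[ℂ] L2Circle :=
  (ContinuousLinearMap.mul ℂ ℂ).holderL ell ∞ 2 2 (hb.toLp b)

theorem coeFn_mulCLM (b : UCircle → ℂ) (hb : MemLp b ∞ ell) (g : L2Circle) :
    mulCLM b hb g =ᵐ[ell] fun x => b x * g x := by
  filter_upwards [ContinuousLinearMap.coeFn_holder (r := 2) (ContinuousLinearMap.mul ℂ ℂ)
    (hb.toLp b) g, hb.coeFn_toLp] with x h1 h2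
  rw [← h2]
  exact h1

theorem inner_eq_integral (x y : L2Circle) : ⟪x, y⟫_ℂ = ∫ t, conj (x t) * y t ∂ell := by
  rw [L2.inner_def]
  simp only [RCLike.inner_apply, mul_comm]

theorem mulCLM_comm (b c : UCircle → ℂ) (hb : MemLp b ∞ ell) (hc : MemLp c ∞ ell) (x : L2Circle) :
    mulCLM b hb (mulCLM c hc x) = mulCLM c hc (mulCLM b hb x) := by
  apply Lp.ext
  filter_upwards [coeFn_mulCLM b hb x, coeFn_mulCLM c hc x, coeFn_mulCLM b hb (mulCLM c hc x),
    coeFn_mulCLM c hc (mulCLM b hb x)] with t h1 h2 h3 h4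
  rw [h3, h4, h1, h2]
  ring

theorem norm_fourier_apply (n : ℤ) (x : UCircle) : ‖(fourier n x : ℂ)‖ = 1 := by
  rw [fourier_apply]
  exact Circle.norm_coe _

theorem memLp_fourier (n : ℤ) : MemLp (fun x : UCircle => (fourier n x : ℂ)) ∞ ell :=
  memLp_top_of_bound (fourier n).continuous.aestronglyMeasurable 1
    (ae_of_all _ fun x => (norm_fourier_apply n x).le)

/-- Multiplication by `z ^ n` on `L²` of the circle. -/
def shift (n : ℤ) : L2Circle →L[ℂ] L2Circle := mulCLM (fun x => fourier n x) (memLp_fourier n)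

theorem coeFn_shift (n : ℤ) (g : L2Circle) : shift n g =ᵐ[ell] fun x => fourier n x * g x :=
  coeFn_mulCLM _ _ g

theorem shift_shift (m n : ℤ) (g : L2Circle) : shift m (shift n g) = shift (m + n) g := by
  apply Lp.ext
  filter_upwards [coeFn_shift n g, coeFn_shift m (shift n g), coeFn_shift (m + n) g]
    with t h1 h2 h3
  rw [h3, h2, h1, fourier_add]
  ring

theorem inner_shift_left (n : ℤ) (x y : L2Circle) : ⟪shift n x, y⟫_ℂ = ⟪x, shift (-n) y⟫_ℂ := by
  rw [inner_eq_integral, inner_eq_integral]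
  refine integral_congr_ae ?_
  filter_upwards [coeFn_shift n x, coeFn_shift (-n) y] with t h1 h2
  rw [h1, h2, map_mul, fourier_neg]
  ring

/-- The monomial `z ^ n` as an element of `L²` of the circle. -/
abbrev zpow (n : ℤ) : L2Circle := fourierLp 2 n

theorem coeFn_zpow (n : ℤ) : zpow n =ᵐ[ell] fun x => fourier n x := coeFn_fourierLp 2 n

theorem shift_zpow (m n : ℤ) : shift m (zpow n) = zpow (m + n) := by
  apply Lp.ext
  filter_upwards [coeFn_shift m (zpow n), coeFn_zpow n, coeFn_zpow (m + n)] with t h1 h2 h3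
  rw [h1, h2, h3, fourier_add]

theorem fourierCoeff_eq_inner (g : L2Circle) (n : ℤ) :
    fourierCoeff (g : UCircle → ℂ) n = ⟪zpow n, g⟫_ℂ := by
  rw [← fourierBasis_repr, HilbertBasis.repr_apply_apply, coe_fourierBasis]

theorem mem_hardyH2_iff {g : L2Circle} : g ∈ hardyH2 ↔ ∀ n : ℤ, n < 0 → ⟪zpow n, g⟫_ℂ = 0 := by
  simp only [← fourierCoeff_eq_inner]
  rfl

theorem hasSum_inner_zpow (x y : L2Circle) :
    HasSum (fun n : ℤ => ⟪x, zpow n⟫_ℂ * ⟪zpow n, y⟫_ℂ) ⟪x, y⟫_ℂ := by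
  have := (fourierBasis (T := 2 * Real.pi)).hasSum_inner_mul_inner x y
  rwa [coe_fourierBasis] at this

theorem eq_zero_of_forall_inner_zpow {x : L2Circle} (h : ∀ n : ℤ, ⟪zpow n, x⟫_ℂ = 0) : x = 0 := by
  have := hasSum_inner_zpow x x
  simp only [h, mul_zero] at this
  exact inner_self_eq_zero.1 (this.unique hasSum_zero)

theorem zpow_mem_hardyH2 {n : ℤ} (hn : 0 ≤ n) : zpow n ∈ hardyH2 := by
  rw [mem_hardyH2_iff]
  intro m hm
  exact orthonormal_fourier.2 (by lia)

theorem integrable_coe (g : L2Circle) : Integrable g ell := (Lp.memLp g).integrable (by norm_num)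

/-- If `φ ∈ L²` is orthogonal to `z ^ n φ` for all `n ≥ 1`, it has constant modulus. -/
theorem norm_sq_ae_eq_of_inner_shift_eq_zero {φ : L2Circle}
    (h : ∀ n : ℤ, 0 < n → ⟪φ, shift n φ⟫_ℂ = 0) : ∀ᵐ x ∂ell, ‖φ x‖ ^ 2 = ‖φ‖ ^ 2 := by
  have hsq : Integrable (fun x => conj (φ x) * φ x) ell := by
    have := L2.integrable_inner (𝕜 := ℂ) φ φ
    simpa only [RCLike.inner_apply, mul_comm] using this
  have hcoef : ∀ n : ℤ, n ≠ 0 → ∫ x, fourier n x * (conj (φ x) * φ x) ∂ell = 0 := by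
    have key : ∀ n : ℤ, ∫ x, fourier n x * (conj (φ x) * φ x) ∂ell = ⟪φ, shift n φ⟫_ℂ := by
      intro n
      rw [inner_eq_integral]
      refine integral_congr_ae ?_
      filter_upwards [coeFn_shift n φ] with x hx
      rw [hx]; ring
    intro n hn
    rw [key]
    rcases lt_or_gt_of_ne hn with hn | hn
    -- Negative indices follow by conjugation, `|φ|²` being real.
    · have := inner_shift_left (-n) φ φ
      rw [neg_neg] at this
      rw [← this, ← inner_conj_symm, h (-n) (by lia), map_zero]
    · exact h n hn
  have hzero : (fun x => conj (φ x) * φ x - ((‖φ‖ ^ 2 : ℝ) : ℂ)) =ᵐ[ell] 0 := by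
    refine ae_eq_zero_of_forall_integral_fourier_mul (hsq.sub (integrable_const _)) fun n => ?_
    simp only [mul_sub]
    have hfi : Integrable (fun x : UCircle => (fourier n x : ℂ)) ell :=
      (memLp_fourier n).integrable le_top
    rw [integral_sub (hsq.bdd_mul (memLp_fourier n).aestronglyMeasurable
      (ae_of_all _ fun x => (norm_fourier_apply n x).le)) (hfi.mul_const _), integral_mul_const]
    have hf1 : ∫ x : UCircle, (fourier n x : ℂ) ∂ell = ⟪zpow 0, zpow n⟫_ℂ := by
      rw [inner_eq_integral]
      refine integral_congr_ae ?_
      filter_upwards [coeFn_zpow 0, coeFn_zpow n] with x h0 h1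
      rw [h0, h1, fourier_zero]; simp
    by_cases hn : n = 0
    · subst hn
      simp only [fourier_zero, one_mul]
      rw [← inner_eq_integral, inner_self_eq_norm_sq_to_K]
      simp
    · rw [hcoef n hn, hf1, orthonormal_fourier.2 (Ne.symm hn), zero_mul, sub_zero]
  filter_upwards [hzero] with x hx
  have hx' := sub_eq_zero.1 hx
  rw [mul_comm, Complex.mul_conj, Complex.normSq_eq_norm_sq] at hx'
  exact_mod_cast hx'

/-! ### Truncation to a set. -/

theorem memLp_indicator_one {E : Set UCircle} (hE : NullMeasurableSet E ell) :
    MemLp (E.indicator fun _ => (1 : ℂ)) ∞ ell := by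
  refine memLp_top_of_bound (aestronglyMeasurable_const.indicator₀ hE) 1 (ae_of_all _ fun x => ?_)
  by_cases hx : x ∈ E <;> simp [hx]

/-- Multiplication by the indicator function of `E` on `L²` of the circle. -/
def cut (E : Set UCircle) (hE : NullMeasurableSet E ell) : L2Circle →L[ℂ] L2Circle :=
  mulCLM _ (memLp_indicator_one hE)

section Cut

variable {E : Set UCircle} (hE : NullMeasurableSet E ell)

theorem coeFn_cut (x : L2Circle) : cut E hE x =ᵐ[ell] E.indicator x := by
  filter_upwards [coeFn_mulCLM _ (memLp_indicator_one hE) x] with t ht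
  rw [cut, ht]
  by_cases h : t ∈ E <;> simp [h]

theorem cut_eq_zero_iff {x : L2Circle} : cut E hE x = 0 ↔ ∀ᵐ t ∂ell, t ∈ E → x t = 0 := by
  constructor
  · intro h
    have h0 : cut E hE x =ᵐ[ell] 0 := by rw [h]; exact Lp.coeFn_zero _ _ _
    filter_upwards [h0, coeFn_cut hE x] with t h1 h2 ht
    rw [h2] at h1
    simpa [ht] using h1
  · intro h
    apply Lp.ext
    filter_upwards [h, coeFn_cut hE x, Lp.coeFn_zero ℂ 2 ell] with t h1 h2 h3
    rw [h2, h3]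
    by_cases ht : t ∈ E <;> simp [ht, h1]

theorem norm_cut_le (x : L2Circle) : ‖cut E hE x‖ ≤ ‖x‖ := by
  refine Lp.norm_le_norm_of_ae_le ?_
  filter_upwards [coeFn_cut hE x] with t ht
  rw [ht]
  exact norm_indicator_le_norm_self _ _

theorem inner_cut_left (x y : L2Circle) : ⟪cut E hE x, y⟫_ℂ = ⟪x, cut E hE y⟫_ℂ := by
  rw [inner_eq_integral, inner_eq_integral]
  refine integral_congr_ae ?_
  filter_upwards [coeFn_cut hE x, coeFn_cut hE y] with t h1 h2
  rw [h1, h2]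
  by_cases ht : t ∈ E <;> simp [ht]

theorem cut_cut (x : L2Circle) : cut E hE (cut E hE x) = cut E hE x := by
  apply Lp.ext
  filter_upwards [coeFn_cut hE x, coeFn_cut hE (cut E hE x)] with t h1 h2
  rw [h2]
  by_cases ht : t ∈ E <;> simp [ht, h1]

theorem cut_add_cut_compl (x : L2Circle) : cut E hE x + cut Eᶜ hE.compl x = x := by
  apply Lp.ext
  filter_upwards [coeFn_cut hE x, coeFn_cut hE.compl x,
    Lp.coeFn_add (cut E hE x) (cut Eᶜ hE.compl x)] with t h1 h2 h3
  rw [h3, Pi.add_apply, h1, h2]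
  by_cases ht : t ∈ E <;> simp [ht]

theorem cut_shift (n : ℤ) (x : L2Circle) : cut E hE (shift n x) = shift n (cut E hE x) :=
  mulCLM_comm _ _ _ _ _

end Cut

/-! ### Shift-generated subspaces and uniqueness in `H²`. -/

/-- The closed linear span of the functions `z ^ n g`, `n ≥ 1`. -/
def shiftClosure (g : L2Circle) : Submodule ℂ L2Circle :=
  (Submodule.span ℂ (Set.range fun n : ℕ => shift (n + 1) g)).topologicalClosure

theorem isClosed_shiftClosure (g : L2Circle) : IsClosed (shiftClosure g : Set L2Circle) :=
  Submodule.isClosed_topologicalClosure _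

instance (g : L2Circle) : CompleteSpace (shiftClosure g) :=
  (isClosed_shiftClosure g).completeSpace_coe

theorem shiftClosure_le {g : L2Circle} {V : Submodule ℂ L2Circle} (hV : IsClosed (V : Set L2Circle))
    (h : ∀ n : ℤ, 0 < n → shift n g ∈ V) : shiftClosure g ≤ V := by
  refine Submodule.topologicalClosure_minimal _ ?_ hV
  rw [Submodule.span_le]
  rintro _ ⟨n, rfl⟩
  exact h _ (by lia)

theorem shift_mem_shiftClosure (g : L2Circle) {n : ℤ} (hn : 0 < n) :
    shift n g ∈ shiftClosure g := by
  refine Submodule.le_topologicalClosure _ (Submodule.subset_span ⟨(n - 1).toNat, ?_⟩)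
  have : (((n - 1).toNat : ℤ) + 1) = n := by lia
  simp only [this]

theorem shift_mem_shiftClosure_of_mem {g x : L2Circle} (hx : x ∈ shiftClosure g) {n : ℤ}
    (hn : 0 < n) : shift n x ∈ shiftClosure g := by
  have hle : shiftClosure g ≤ (shiftClosure g).comap (shift n : L2Circle →ₗ[ℂ] L2Circle) := by
    refine shiftClosure_le ((isClosed_shiftClosure g).preimage (shift n).continuous) fun m hm => ?_
    rw [Submodule.mem_comap, ContinuousLinearMap.coe_coe, shift_shift]
    exact shift_mem_shiftClosure g (by lia)
  exact Submodule.mem_comap.1 (hle hx)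

/-- The component of `g` orthogonal to `z ^ n g`, `n ≥ 1`. -/
def innovation (g : L2Circle) : L2Circle := g - (shiftClosure g).starProjection g

theorem sub_innovation_mem (g : L2Circle) : g - innovation g ∈ shiftClosure g := by
  rw [innovation, sub_sub_cancel]
  exact Submodule.starProjection_apply_mem _ _

theorem inner_innovation {g y : L2Circle} (hy : y ∈ shiftClosure g) : ⟪innovation g, y⟫_ℂ = 0 :=
  Submodule.starProjection_inner_eq_zero _ _ hy

theorem norm_sq_innovation_ae (g : L2Circle) :
    ∀ᵐ x ∂ell, ‖innovation g x‖ ^ 2 = ‖innovation g‖ ^ 2 := by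
  refine norm_sq_ae_eq_of_inner_shift_eq_zero fun n hn => inner_innovation ?_
  rw [innovation, map_sub]
  exact sub_mem (shift_mem_shiftClosure g hn)
    (shift_mem_shiftClosure_of_mem (Submodule.starProjection_apply_mem _ _) hn)

theorem norm_innovation_le {g y : L2Circle} (hy : y ∈ shiftClosure g) :
    ‖innovation g‖ ≤ ‖g - y‖ := by
  have h1 : ⟪innovation g, g - y⟫_ℂ = ⟪innovation g, innovation g⟫_ℂ := by
    have : g - y = innovation g + ((g - innovation g) - y) := by abel
    rw [this, inner_add_right, inner_innovation (sub_mem (sub_innovation_mem g) hy), add_zero]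
  have h2 := norm_inner_le_norm (𝕜 := ℂ) (innovation g) (g - y)
  rw [h1, inner_self_eq_norm_sq_to_K] at h2
  have h3 : ‖innovation g‖ ^ 2 ≤ ‖innovation g‖ * ‖g - y‖ := by simpa using h2
  by_contra! hlt
  nlinarith [norm_nonneg (g - y), norm_nonneg (innovation g)]

/-- A function vanishing on a set of positive measure lies in the closed span of its proper
positive shifts. -/
theorem mem_shiftClosure_self {E : Set UCircle} (hE : NullMeasurableSet E ell) (hpos : 0 < ell E)
    {g : L2Circle} (hg : cut E hE g = 0) : g ∈ shiftClosure g := by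
  have hN : shiftClosure g ≤ (cut E hE).ker := by
    refine shiftClosure_le (cut E hE).isClosed_ker fun n _ => ?_
    change cut E hE (shift n g) = 0
    rw [cut_shift, hg, map_zero]
  -- The innovation inherits vanishing on `E`; its modulus being constant, it is zero.
  have hφ : cut E hE (innovation g) = 0 := by
    have : cut E hE (g - innovation g) = 0 := hN (sub_innovation_mem g)
    rwa [map_sub, hg, zero_sub, neg_eq_zero] at this
  have hzero : innovation g = 0 := by
    by_contra hne
    refine hpos.ne' (measure_eq_zero_iff_ae_notMem.2 ?_)
    filter_upwards [(cut_eq_zero_iff hE).1 hφ, norm_sq_innovation_ae g] with x h1 h2 hx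
    rw [h1 hx, norm_zero, zero_pow two_ne_zero] at h2
    exact hne (norm_eq_zero.1 (pow_eq_zero_iff two_ne_zero |>.1 h2.symm))
  have := sub_innovation_mem g
  rwa [hzero, sub_zero] at this

/-- A function of `H²` vanishing on a set of positive measure is zero. -/
theorem hardyH2_eq_zero_of_cut_eq_zero {E : Set UCircle} (hE : NullMeasurableSet E ell)
    (hpos : 0 < ell E) {g : L2Circle} (hg : g ∈ hardyH2) (hcut : cut E hE g = 0) : g = 0 := by
  rw [mem_hardyH2_iff] at hg
  have hmem := mem_shiftClosure_self hE hpos hcut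
  -- `g` is a limit of combinations of `z ^ k g`, `k ≥ 1`, whose `n`-th coefficient is the `(n -
  -- k)`-th coefficient of `g`: zero by induction, or because the index is negative.
  have hnat : ∀ n : ℕ, ⟪zpow n, g⟫_ℂ = 0 := by
    intro n
    induction n using Nat.strong_induction_on with
    | _ n ih =>
      have hle : shiftClosure g ≤ (innerSL ℂ (zpow (n : ℤ))).ker := by
        refine shiftClosure_le (innerSL ℂ (zpow (n : ℤ))).isClosed_ker fun k hk => ?_
        change ⟪zpow n, shift k g⟫_ℂ = 0
        have := inner_shift_left (-k) (zpow n) g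
        rw [neg_neg, shift_zpow] at this
        rw [← this]
        rcases lt_or_ge (-k + n) 0 with h | h
        · exact hg _ h
        · obtain ⟨j, hj⟩ := Int.eq_ofNat_of_zero_le h
          rw [hj]
          exact ih j (by lia)
      exact hle hmem
  refine eq_zero_of_forall_inner_zpow fun n => ?_
  rcases lt_or_ge n 0 with h | h
  · exact hg n h
  · obtain ⟨j, rfl⟩ := Int.eq_ofNat_of_zero_le h
    exact hnat j

theorem isClosed_hardyH2 : IsClosed (hardyH2 : Set L2Circle) := by
  have : (hardyH2 : Set L2Circle) = ⋂ n : ℤ, ⋂ _ : n < 0, {g | ⟪zpow n, g⟫_ℂ = 0} := by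
    ext g
    simp only [SetLike.mem_coe, mem_hardyH2_iff, Set.mem_iInter, Set.mem_ofPred_eq]
  rw [this]
  exact isClosed_iInter fun n => isClosed_iInter fun _ =>
    isClosed_eq (by fun_prop) continuous_const

/-! ### Szegő's extremal problem and functions of prescribed modulus. -/

/-- The functions in `H²` with mean zero. -/
def hardyZero : Submodule ℂ L2Circle := hardyH2 ⊓ (innerSL ℂ (zpow 0)).ker

theorem mem_hardyZero_iff {x : L2Circle} :
    x ∈ hardyZero ↔ x ∈ hardyH2 ∧ ⟪zpow 0, x⟫_ℂ = 0 := Iff.rfl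

theorem isClosed_hardyZero : IsClosed (hardyZero : Set L2Circle) :=
  isClosed_hardyH2.inter (innerSL ℂ (zpow 0)).isClosed_ker

theorem zpow_mem_hardyZero {n : ℤ} (hn : 0 < n) : zpow n ∈ hardyZero :=
  mem_hardyZero_iff.2 ⟨zpow_mem_hardyH2 hn.le, orthonormal_fourier.2 (by lia)⟩

theorem inner_zpow_zero_self : ⟪zpow 0, zpow 0⟫_ℂ = 1 := by
  rw [inner_self_eq_norm_sq_to_K, orthonormal_fourier.1 0]
  simp

/-- Multiplication by `b` commutes with shifts; hence the weighted distance from `1` to polynomials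
without constant term is bounded below by the norm of the innovation of `b`. -/
theorem mulCLM_mem_shiftClosure {b : UCircle → ℂ} (hb : MemLp b ∞ ell) {q : L2Circle}
    (hq : q ∈ Submodule.span ℂ (Set.range fun n : ℕ => zpow (n + 1))) :
    mulCLM b hb q ∈ shiftClosure (mulCLM b hb (zpow 0)) := by
  have : Submodule.span ℂ (Set.range fun n : ℕ => zpow (n + 1)) ≤
      (shiftClosure (mulCLM b hb (zpow 0))).comap (mulCLM b hb : L2Circle →ₗ[ℂ] L2Circle) := by
    rw [Submodule.span_le]
    rintro _ ⟨n, rfl⟩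
    have h := shift_mem_shiftClosure (mulCLM b hb (zpow 0)) (n := n + 1) (by lia)
    rw [shift, mulCLM_comm] at h
    have h2 : shift (n + 1) (zpow 0) = zpow (n + 1) := by rw [shift_zpow, add_zero]
    rw [shift] at h2
    rw [h2] at h
    exact h
  exact Submodule.mem_comap.1 (this hq)

/-- On a set whose complement has positive measure, the constant `1` is an `L²` limit of
polynomials in `z` without constant term. -/
theorem exists_polynomial_close_to_one {A : Set UCircle} (hA : NullMeasurableSet A ell)
    (hpos : 0 < ell Aᶜ) {η : ℝ} (hη : 0 < η) :
    ∃ q ∈ Submodule.span ℂ (Set.range fun n : ℕ => zpow (n + 1)),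
      ‖cut A hA (zpow 0 - q)‖ < η := by
  -- The indicator of `A` vanishes on a set of positive measure.
  have hmem : cut A hA (zpow 0) ∈ shiftClosure (cut A hA (zpow 0)) := by
    refine mem_shiftClosure_self hA.compl hpos ?_
    rw [cut_eq_zero_iff]
    filter_upwards [coeFn_cut hA (zpow 0)] with t ht htA
    rw [ht]
    exact Set.indicator_of_notMem htA _
  have hspan : Submodule.span ℂ (Set.range fun n : ℕ => shift (n + 1) (cut A hA (zpow 0))) =
      (Submodule.span ℂ (Set.range fun n : ℕ => zpow (n + 1))).map
        (cut A hA : L2Circle →ₗ[ℂ] L2Circle) := by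
    rw [Submodule.map_span, ← Set.range_comp]
    congr 2
    funext n
    change _ = cut A hA (zpow (n + 1))
    rw [← cut_shift, shift_zpow, add_zero]
  obtain ⟨y, hy, hdist⟩ := Metric.mem_closure_iff.1
    (show cut A hA (zpow 0) ∈ closure (Submodule.span ℂ (Set.range fun n : ℕ =>
      shift (n + 1) (cut A hA (zpow 0))) : Set L2Circle) from hmem) η hη
  rw [SetLike.mem_coe, hspan] at hy
  obtain ⟨q, hq, rfl⟩ := hy
  refine ⟨q, hq, ?_⟩
  rw [map_sub]
  rwa [dist_eq_norm] at hdist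

open Classical in
/-- The weight equal to `δ` on `E` and `1` off `E`. -/
def stepWeight (E : Set UCircle) (δ : ℝ) (x : UCircle) : ℂ := if x ∈ E then (δ : ℂ) else 1

theorem memLp_stepWeight {E : Set UCircle} (hE : NullMeasurableSet E ell) (δ : ℝ) :
    MemLp (stepWeight E δ) ∞ ell := by
  have : stepWeight E δ = fun x => 1 + E.indicator (fun _ => ((δ : ℂ) - 1)) x := by
    funext x
    by_cases hx : x ∈ E <;> simp [stepWeight, hx]
  rw [this]
  refine memLp_top_of_bound (aestronglyMeasurable_const.add
    (aestronglyMeasurable_const.indicator₀ hE)) (1 + ‖(δ : ℂ) - 1‖) (ae_of_all _ fun x => ?_)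
  refine (norm_add_le _ _).trans ?_
  rw [norm_one]
  exact add_le_add_right (norm_indicator_le_norm_self (fun _ => ((δ : ℂ) - 1)) x) _

theorem norm_mulCLM_stepWeight_le {E : Set UCircle} (hE : NullMeasurableSet E ell) {δ : ℝ}
    (hδ : 0 < δ) (x : L2Circle) :
    ‖mulCLM _ (memLp_stepWeight hE δ) x‖ ≤ ‖cut Eᶜ hE.compl x‖ + δ * ‖x‖ := by
  have : mulCLM _ (memLp_stepWeight hE δ) x = cut Eᶜ hE.compl x + (δ : ℂ) • cut E hE x := by
    apply Lp.ext
    filter_upwards [coeFn_mulCLM _ (memLp_stepWeight hE δ) x, coeFn_cut hE.compl x,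
      coeFn_cut hE x, Lp.coeFn_add (cut Eᶜ hE.compl x) ((δ : ℂ) • cut E hE x),
      Lp.coeFn_smul (δ : ℂ) (cut E hE x)] with t h1 h2 h3 h4 h5
    rw [h1, h4, Pi.add_apply, h5, Pi.smul_apply, h2, h3]
    by_cases ht : t ∈ E <;> simp [ht, stepWeight]
  rw [this]
  refine (norm_add_le _ _).trans (add_le_add_right ?_ _)
  rw [norm_smul, Complex.norm_real, Real.norm_of_nonneg hδ.le]
  exact mul_le_mul_of_nonneg_left (norm_cut_le hE x) hδ.le

/-- For a bounded weight `b` with bounded inverse `b'`, there is a function in `H²` whose modulus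
is `|b'|` almost everywhere and whose mean is the inverse of the `L²` distance of `b` to its
positive shifts. -/
theorem exists_hardyH2_norm_eq {b b' : UCircle → ℂ} (hb : MemLp b ∞ ell) (hb' : MemLp b' ∞ ell)
    (hbb' : ∀ x, b' x * b x = 1) :
    ∃ m ∈ hardyH2, (∀ᵐ x ∂ell, ‖m x‖ = ‖b' x‖) ∧ 0 < ‖⟪zpow 0, m⟫_ℂ‖ ∧
      ∀ q ∈ Submodule.span ℂ (Set.range fun n : ℕ => zpow (n + 1)),
        ‖⟪zpow 0, m⟫_ℂ‖⁻¹ ≤ ‖mulCLM b hb (zpow 0 - q)‖ := by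
  have hinv : ∀ x, mulCLM b' hb' (mulCLM b hb x) = x := by
    intro x
    apply Lp.ext
    filter_upwards [coeFn_mulCLM b hb x, coeFn_mulCLM b' hb' (mulCLM b hb x)] with t h1 h2
    rw [h2, h1, ← mul_assoc, hbb', one_mul]
  -- Multiplication by `b'` sends `z ^ n b` to `z ^ n`, so `b' φ` differs from `1` by an element of
  -- `hardyZero`: it is in `H²` with mean `1`. Since `|φ|` is the constant `‖φ‖`, dividing by it
  -- gives modulus `|b'|` and mean `‖φ‖⁻¹`.
  obtain ⟨φ, hφ⟩ : ∃ φ, φ = innovation (mulCLM b hb (zpow 0)) := ⟨_, rfl⟩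
  have hN : shiftClosure (mulCLM b hb (zpow 0)) ≤
      hardyZero.comap (mulCLM b' hb' : L2Circle →ₗ[ℂ] L2Circle) := by
    refine shiftClosure_le (isClosed_hardyZero.preimage (mulCLM b' hb').continuous) fun n hn => ?_
    have : mulCLM b' hb' (shift n (mulCLM b hb (zpow 0))) = zpow n := by
      rw [shift, mulCLM_comm, ← shift, hinv, shift_zpow, add_zero]
    rw [Submodule.mem_comap, ContinuousLinearMap.coe_coe, this]
    exact zpow_mem_hardyZero hn
  obtain ⟨p, hpdef⟩ : ∃ p, p = mulCLM b' hb' φ := ⟨_, rfl⟩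
  have hmem : zpow 0 - p ∈ hardyZero := by
    have := hN (sub_innovation_mem _)
    rwa [Submodule.mem_comap, ContinuousLinearMap.coe_coe, map_sub, hinv, ← hφ, ← hpdef] at this
  have hp : p ∈ hardyH2 := by
    have := sub_mem (zpow_mem_hardyH2 le_rfl) (mem_hardyZero_iff.1 hmem).1
    rwa [sub_sub_cancel] at this
  have hmean : ⟪zpow 0, p⟫_ℂ = 1 := by
    have := (mem_hardyZero_iff.1 hmem).2
    rw [inner_sub_right, inner_zpow_zero_self, sub_eq_zero] at this
    exact this.symm
  have hφpos : 0 < ‖φ‖ := by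
    rw [norm_pos_iff]
    intro h
    rw [hpdef, h, map_zero, inner_zero_right] at hmean
    exact zero_ne_one hmean
  have hval : ‖⟪zpow 0, ((‖φ‖⁻¹ : ℝ) : ℂ) • p⟫_ℂ‖ = ‖φ‖⁻¹ := by
    rw [inner_smul_right, hmean, mul_one, Complex.norm_real, norm_inv, norm_norm]
  refine ⟨((‖φ‖⁻¹ : ℝ) : ℂ) • p, Submodule.smul_mem _ _ hp, ?_, ?_, fun q hq => ?_⟩
  · filter_upwards [norm_sq_innovation_ae (mulCLM b hb (zpow 0)),
      Lp.coeFn_smul ((‖φ‖⁻¹ : ℝ) : ℂ) p, coeFn_mulCLM b' hb' φ] with x h1 h2 h3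
    rw [← hφ] at h1
    rw [← hpdef] at h3
    have h4 : ‖φ x‖ = ‖φ‖ := (pow_left_inj₀ (norm_nonneg _) (norm_nonneg _) two_ne_zero).1 h1
    rw [h2, Pi.smul_apply, h3, norm_smul, norm_mul, h4, Complex.norm_real, norm_inv, norm_norm]
    field_simp
  · rw [hval]
    exact inv_pos.2 hφpos
  · rw [hval, inv_inv, map_sub, hφ]
    exact norm_innovation_le (mulCLM_mem_shiftClosure _ hq)

/-- There are bounded functions in `H²` of modulus at most `1` off a given set of positive measure
whose mean is arbitrarily large. -/
theorem exists_hardyH2_large_mean {E : Set UCircle} (hE : NullMeasurableSet E ell)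
    (hpos : 0 < ell E) {K : ℝ} (hK : 0 < K) :
    ∃ m ∈ hardyH2, (∃ B : ℝ, ∀ᵐ x ∂ell, ‖m x‖ ≤ B) ∧ (∀ᵐ x ∂ell, x ∉ E → ‖m x‖ ≤ 1) ∧
      K ≤ ‖⟪zpow 0, m⟫_ℂ‖ := by
  obtain ⟨q, hq, hqη⟩ := exists_polynomial_close_to_one hE.compl (by rwa [compl_compl])
    (η := 1 / (2 * K)) (by positivity)
  -- `q` makes `1 - q` small off `E` with no control on `E`; the weight `δ`, chosen after `q`,
  -- absorbs the rest. The two halves bound the weighted distance by `K⁻¹`.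
  obtain ⟨δ, hδ, hδq⟩ : ∃ δ : ℝ, 0 < δ ∧ δ * ‖zpow 0 - q‖ ≤ 1 / (2 * K) := by
    refine ⟨1 / (2 * K * (‖zpow 0 - q‖ + 1)), by positivity, ?_⟩
    rw [div_mul_eq_mul_div, one_mul, div_le_div_iff₀ (by positivity) (by positivity)]
    nlinarith [norm_nonneg (zpow 0 - q)]
  have hδC : (δ : ℂ) ≠ 0 := by exact_mod_cast hδ.ne'
  obtain ⟨m, hm, hmod, hpos', hdist⟩ := exists_hardyH2_norm_eq (memLp_stepWeight hE δ)
    (memLp_stepWeight hE δ⁻¹) (fun x => by by_cases h : x ∈ E <;> simp [h, stepWeight, hδC])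
  refine ⟨m, hm, ⟨max δ⁻¹ 1, ?_⟩, ?_, ?_⟩
  · filter_upwards [hmod] with x hx
    rw [hx]
    by_cases h : x ∈ E <;> simp [h, stepWeight, abs_of_pos hδ]
  · filter_upwards [hmod] with x hx h
    rw [hx]
    simp [h, stepWeight]
  · have h1 := (hdist q hq).trans (norm_mulCLM_stepWeight_le hE hδ (zpow 0 - q))
    have h2 : 1 / (2 * K) + 1 / (2 * K) = K⁻¹ := by field_simp; norm_num
    exact (inv_le_inv₀ hpos' hK).1 (by linarith)

/-! ### Functions orthogonal to `H²` that are small on a set. -/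

theorem integrable_conj_mul (x y : L2Circle) : Integrable (fun t => conj (x t) * y t) ell := by
  have := L2.integrable_inner (𝕜 := ℂ) x y
  simpa only [RCLike.inner_apply, mul_comm] using this

/-- The constant is `1` because the circle has total mass `1`. -/
theorem integral_norm_le_norm (x : L2Circle) : ∫ t, ‖x t‖ ∂ell ≤ ‖x‖ := by
  have h := eLpNorm_le_eLpNorm_of_exponent_le (μ := ell) (p := 1) (q := 2) (by norm_num)
    (Lp.memLp x).aestronglyMeasurable
  rw [Lp.norm_def, integral_norm_eq_lintegral_enorm (Lp.memLp x).aestronglyMeasurable,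
    ← eLpNorm_one_eq_lintegral_enorm]
  exact ENNReal.toReal_mono (Lp.memLp x).eLpNorm_ne_top h

/-- If functions `e n` orthogonal to `H²` are bounded in `L¹` and tend to zero in `L¹` of a set of
positive measure, then each of their Fourier coefficients tends to zero. -/
theorem tendsto_inner_zpow_zero {E : Set UCircle} (hE : NullMeasurableSet E ell) (hpos : 0 < ell E)
    {e : ℕ → L2Circle} (he : ∀ n, ∀ y ∈ hardyH2, ⟪y, e n⟫_ℂ = 0) {C : ℝ}
    (hC : ∀ n, ∫ x, ‖e n x‖ ∂ell ≤ C)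
    (hlim : Tendsto (fun n => ∫ x in E, ‖e n x‖ ∂ell) atTop (𝓝 0)) (k : ℤ) :
    Tendsto (fun n => ⟪zpow k, e n⟫_ℂ) atTop (𝓝 0) := by
  have hnonneg : ∀ k : ℤ, 0 ≤ k → ∀ n, ⟪zpow k, e n⟫_ℂ = 0 :=
    fun k hk n => he n _ (zpow_mem_hardyH2 hk)
  suffices h : ∀ j : ℕ, Tendsto (fun n => ⟪zpow (-j), e n⟫_ℂ) atTop (𝓝 0) by
    rcases le_total 0 k with hk | hk
    · simp only [hnonneg k hk, tendsto_const_nhds]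
    · have := h k.natAbs
      rwa [Int.ofNat_natAbs_of_nonpos hk, neg_neg] at this
  intro j
  induction j using Nat.strong_induction_on with
  | _ j ih =>
  have hC0 : 0 ≤ C := (integral_nonneg fun _ => norm_nonneg _).trans (hC 0)
  rw [Metric.tendsto_atTop]
  intro ε hε
  -- The pairing of `z ^ (-j) m` with `e n` costs at most about `C`, while the mean of `m`
  -- multiplies the wanted coefficient; `(C + 2) / ε` leaves the coefficient at most `(C + 1) ε / (C
  -- + 2)`.
  obtain ⟨m, hm, ⟨B, hB⟩, hm1, hK⟩ := exists_hardyH2_large_mean hE hpos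
    (K := (C + 2) / ε) (by positivity)
  have hB0 : ∀ᵐ x ∂ell, ‖m x‖ ≤ |B| := hB.mono fun x hx => hx.trans (le_abs_self B)
  -- Parseval reduces to a finite sum: `z ^ (-j) m` has no index below `-j`, and `e n` has no index
  -- `≥ 0`. The terms strictly between are handled by induction.
  have hexp : ∀ n, ⟪shift (-j) m, e n⟫_ℂ = ⟪m, zpow 0⟫_ℂ * ⟪zpow (-j), e n⟫_ℂ +
      ∑ i ∈ Finset.Ioo (-(j : ℤ)) 0, ⟪shift (-j) m, zpow i⟫_ℂ * ⟪zpow i, e n⟫_ℂ := by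
    intro n
    have h1 : HasSum (fun i : ℤ => ⟪shift (-j) m, zpow i⟫_ℂ * ⟪zpow i, e n⟫_ℂ)
        (∑ i ∈ insert (-(j : ℤ)) (Finset.Ioo (-(j : ℤ)) 0),
          ⟪shift (-j) m, zpow i⟫_ℂ * ⟪zpow i, e n⟫_ℂ) := by
      refine hasSum_sum_of_ne_finset_zero fun i hi => ?_
      rw [Finset.mem_insert, Finset.mem_Ioo, not_or, not_and_or] at hi
      rcases le_or_gt 0 i with h | h
      · rw [hnonneg i h n, mul_zero]
      · rw [inner_shift_left, shift_zpow, ← inner_conj_symm,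
          mem_hardyH2_iff.1 hm _ (by lia), map_zero, zero_mul]
    rw [(hasSum_inner_zpow _ _).unique h1, Finset.sum_insert (by simp), inner_shift_left,
      shift_zpow, neg_neg, add_neg_cancel]
  have hsum : Tendsto (fun n => ∑ i ∈ Finset.Ioo (-(j : ℤ)) 0,
      ⟪shift (-j) m, zpow i⟫_ℂ * ⟪zpow i, e n⟫_ℂ) atTop (𝓝 0) := by
    rw [show (0 : ℂ) = ∑ i ∈ Finset.Ioo (-(j : ℤ)) 0, ⟪shift (-j) m, zpow i⟫_ℂ * 0 by simp]
    refine tendsto_finsetSum _ fun i hi => Tendsto.const_mul _ ?_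
    rw [Finset.mem_Ioo] at hi
    have := ih i.natAbs (by lia)
    rwa [Int.ofNat_natAbs_of_nonpos hi.2.le, neg_neg] at this
  have hbound : ∀ n, ‖⟪shift (-j) m, e n⟫_ℂ‖ ≤ |B| * (∫ x in E, ‖e n x‖ ∂ell) + C := by
    intro n
    rw [inner_eq_integral]
    refine (norm_integral_le_integral_norm _).trans ?_
    have hi := (integrable_coe (e n)).norm
    calc ∫ x, ‖conj (shift (-j) m x) * e n x‖ ∂ell
        ≤ ∫ x, (|B| * E.indicator (fun x => ‖e n x‖) x + ‖e n x‖) ∂ell := by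
          refine integral_mono_ae (integrable_conj_mul _ _).norm
            (((hi.indicator₀ hE).const_mul _).add hi) ?_
          filter_upwards [hB0, hm1, coeFn_shift (-j) m] with x h1 h2 h3
          rw [norm_mul, RCLike.norm_conj, h3, norm_mul, norm_fourier_apply, one_mul]
          by_cases hx : x ∈ E
          · rw [Set.indicator_of_mem hx]
            nlinarith [mul_le_mul_of_nonneg_right h1 (norm_nonneg (e n x)), norm_nonneg (e n x)]
          · rw [Set.indicator_of_notMem hx]
            nlinarith [mul_le_mul_of_nonneg_right (h2 hx) (norm_nonneg (e n x))]
      _ = |B| * (∫ x in E, ‖e n x‖ ∂ell) + ∫ x, ‖e n x‖ ∂ell := by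
          rw [integral_add ((hi.indicator₀ hE).const_mul _) hi, integral_const_mul,
            integral_indicator₀ hE]
      _ ≤ _ := by gcongr; exact hC n
  have hsmall : Tendsto (fun n => |B| * (∫ x in E, ‖e n x‖ ∂ell) +
      ‖∑ i ∈ Finset.Ioo (-(j : ℤ)) 0, ⟪shift (-j) m, zpow i⟫_ℂ * ⟪zpow i, e n⟫_ℂ‖)
      atTop (𝓝 0) := by
    simpa using (hlim.const_mul |B|).add hsum.norm
  obtain ⟨N, hN⟩ := eventually_atTop.1 (hsmall.eventually (gt_mem_nhds one_pos))
  refine ⟨N, fun n hn => ?_⟩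
  rw [dist_zero_right]
  have h1 := hN n hn
  have h2 : ‖⟪m, zpow 0⟫_ℂ * ⟪zpow (-j), e n⟫_ℂ‖ ≤ C + 1 := by
    rw [eq_sub_of_add_eq (hexp n).symm]
    refine (norm_sub_le _ _).trans ?_
    linarith [hbound n]
  rw [norm_mul, norm_inner_symm] at h2
  have h3 := mul_le_mul_of_nonneg_right hK (norm_nonneg ⟪zpow (-j), e n⟫_ℂ)
  have h4 : (C + 2) * ‖⟪zpow (-j), e n⟫_ℂ‖ ≤ (C + 1) * ε := by
    have : (C + 2) / ε * ‖⟪zpow (-j), e n⟫_ℂ‖ ≤ C + 1 := h3.trans h2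
    rwa [div_mul_eq_mul_div, div_le_iff₀ hε] at this
  nlinarith

/-! ### From convergence on `I` to weak convergence. -/

/-- A bounded sequence in `H²` which tends to zero in `L²` of a set of positive measure tends weakly
to zero in `L²` of the circle. -/
theorem tendsto_inner_of_tendsto_cut {I : Set UCircle} (hI : NullMeasurableSet I ell)
    (hpos : 0 < ell I) {u : ℕ → L2Circle} (hu : ∀ n, u n ∈ hardyH2) {C : ℝ} (hC : ∀ n, ‖u n‖ ≤ C)
    (hcut : Tendsto (fun n => cut I hI (u n)) atTop (𝓝 0)) (φ : L2Circle) :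
    Tendsto (fun n => ⟪φ, u n⟫_ℂ) atTop (𝓝 0) := by
  let W : Submodule ℂ L2Circle :=
    { carrier := {φ | Tendsto (fun n => ⟪φ, u n⟫_ℂ) atTop (𝓝 0)}
      add_mem' := fun {a b} ha hb => by
        have := Tendsto.add ha hb
        simpa only [Set.mem_ofPred_eq, inner_add_left, add_zero] using this
      zero_mem' := by simp
      smul_mem' := fun c a ha => by
        have := Tendsto.const_mul (conj c) ha
        simpa only [Set.mem_ofPred_eq, inner_smul_left, mul_zero] using this }
  -- An `x` orthogonal to `W` is in `H²`, as `W` contains the negative monomials, and vanishes on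
  -- `I`, as `W` contains `cut I hI x`.
  have hW : W.topologicalClosure = ⊤ := by
    rw [Submodule.topologicalClosure_eq_top_iff, Submodule.eq_bot_iff]
    intro x hx
    have hx' : ∀ w ∈ W, ⟪w, x⟫_ℂ = 0 := (Submodule.mem_orthogonal _ _).1 hx
    have hxH : x ∈ hardyH2 := by
      refine mem_hardyH2_iff.2 fun n hn => hx' _ ?_
      change Tendsto (fun k => ⟪zpow n, u k⟫_ℂ) atTop (𝓝 0)
      simp only [mem_hardyH2_iff.1 (hu _) n hn, tendsto_const_nhds]
    have hxc : ⟪cut I hI x, x⟫_ℂ = 0 := by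
      refine hx' _ ?_
      change Tendsto (fun k => ⟪cut I hI x, u k⟫_ℂ) atTop (𝓝 0)
      simp only [inner_cut_left]
      have := (tendsto_const_nhds (x := x)).inner (𝕜 := ℂ) hcut
      rwa [inner_zero_right] at this
    rw [← cut_cut, inner_cut_left] at hxc
    exact hardyH2_eq_zero_of_cut_eq_zero hI hpos hxH (inner_self_eq_zero.1 hxc)
  have hC0 : 0 ≤ C := (norm_nonneg _).trans (hC 0)
  rw [Metric.tendsto_atTop]
  intro ε hε
  have hφ : φ ∈ closure (W : Set L2Circle) := by
    rw [← Submodule.topologicalClosure_coe, hW]; trivial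
  obtain ⟨ψ, hψ, hdist⟩ := Metric.mem_closure_iff.1 hφ (ε / (2 * (C + 1))) (by positivity)
  obtain ⟨N, hN⟩ := Metric.tendsto_atTop.1 (show Tendsto (fun n => ⟪ψ, u n⟫_ℂ) atTop (𝓝 0) from hψ)
    (ε / 2) (by positivity)
  refine ⟨N, fun n hn => ?_⟩
  have h1 := hN n hn
  rw [dist_zero_right] at h1 ⊢
  rw [dist_eq_norm] at hdist
  have h2 : ⟪φ, u n⟫_ℂ = ⟪φ - ψ, u n⟫_ℂ + ⟪ψ, u n⟫_ℂ := by rw [inner_sub_left]; ring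
  have h3 : ‖⟪φ - ψ, u n⟫_ℂ‖ ≤ ε / (2 * (C + 1)) * C :=
    (norm_inner_le_norm _ _).trans (mul_le_mul hdist.le (hC n) (norm_nonneg _) (by positivity))
  have h4 : ε / (2 * (C + 1)) * C ≤ ε / 2 := by
    rw [div_mul_eq_mul_div, div_le_div_iff₀ (by positivity) (by positivity)]
    nlinarith
  rw [h2]
  exact (norm_add_le _ _).trans_lt (by linarith)

/-- Weak convergence to zero in `L²` together with a uniform bound on `J` implies convergence of the
integrals against every `φ ∈ L¹(J)`. -/
theorem tendsto_setIntegral_mul {J : Set UCircle} (hJ : NullMeasurableSet J ell)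
    {u : ℕ → L2Circle} (hu : ∀ φ : L2Circle, Tendsto (fun n => ⟪φ, u n⟫_ℂ) atTop (𝓝 0)) {C : ℝ}
    (hC : ∀ n, ∀ᵐ x ∂(ell.restrict J), ‖u n x‖ ≤ C) {φ : UCircle → ℂ} (hφ : IntegrableOn φ J ell) :
    Tendsto (fun n => ∫ x in J, u n x * φ x ∂ell) atTop (𝓝 0) := by
  rw [Metric.tendsto_atTop]
  intro ε hε
  obtain ⟨ψ, hψ, hψi⟩ := Integrable.exists_boundedContinuous_integral_sub_le hφ
    (ε := ε / (2 * (|C| + 1))) (by positivity)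
  have hψm : MemLp (fun x => conj (ψ x)) 2 ell :=
    MemLp.of_bound (by fun_prop) ‖ψ‖ (ae_of_all _ fun x => by
      rw [RCLike.norm_conj]; exact ψ.norm_coe_le_norm x)
  have hψu : ∀ n, ∫ x in J, u n x * ψ x ∂ell = ⟪cut J hJ hψm.toLp, u n⟫_ℂ := by
    intro n
    rw [inner_eq_integral, ← integral_indicator₀ hJ]
    refine integral_congr_ae ?_
    filter_upwards [coeFn_cut hJ hψm.toLp, hψm.coeFn_toLp] with x h1 h2
    rw [h1]
    by_cases hx : x ∈ J <;> simp [hx, h2, mul_comm]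
  have hint : ∀ n, ∀ θ : UCircle → ℂ, IntegrableOn θ J ell →
      IntegrableOn (fun x => u n x * θ x) J ell := fun n θ hθ =>
    Integrable.bdd_mul (c := C) hθ (Lp.memLp (u n)).aestronglyMeasurable.restrict (hC n)
  obtain ⟨N, hN⟩ := Metric.tendsto_atTop.1 (hu (cut J hJ hψm.toLp)) (ε / 2) (by positivity)
  refine ⟨N, fun n hn => ?_⟩
  have h1 := hN n hn
  rw [← hψu] at h1
  rw [dist_zero_right] at h1 ⊢
  have h2 : ∫ x in J, u n x * φ x ∂ell =
      (∫ x in J, u n x * (φ x - ψ x) ∂ell) + ∫ x in J, u n x * ψ x ∂ell := by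
    rw [← integral_add (hint n (fun x => φ x - ψ x) (hφ.sub hψi)) (hint n ψ hψi)]
    refine integral_congr_ae (ae_of_all _ fun x => ?_)
    ring
  have h3 : ‖∫ x in J, u n x * (φ x - ψ x) ∂ell‖ ≤ |C| * (ε / (2 * (|C| + 1))) := by
    calc ‖∫ x in J, u n x * (φ x - ψ x) ∂ell‖ ≤ ∫ x in J, ‖u n x * (φ x - ψ x)‖ ∂ell :=
          norm_integral_le_integral_norm _
      _ ≤ ∫ x in J, |C| * ‖φ x - ψ x‖ ∂ell := by
          refine integral_mono_ae (hint n (fun x => φ x - ψ x) (hφ.sub hψi)).norm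
            ((hφ.sub hψi).norm.const_mul _) ?_
          filter_upwards [hC n] with x hx
          rw [norm_mul]
          exact mul_le_mul_of_nonneg_right (hx.trans (le_abs_self C)) (norm_nonneg _)
      _ = |C| * ∫ x in J, ‖φ x - ψ x‖ ∂ell := integral_const_mul _ _
      _ ≤ _ := by gcongr
  have h4 : |C| * (ε / (2 * (|C| + 1))) ≤ ε / 2 := by
    rw [mul_div_assoc', div_le_div_iff₀ (by positivity) (by positivity)]
    nlinarith [abs_nonneg C]
  rw [h2]
  exact (norm_add_le _ _).trans_lt (by linarith)

/-! ### Restriction to `I`, variational inequality and contraction. -/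

section Restrict

variable {I : Set UCircle} (hI : NullMeasurableSet I ell)

/-- Transfers the geometry of `L2On I` to the fixed space `L2Circle`, where `cut I hI` is an
orthogonal projection. -/
theorem inner_restrictL2 (x y : L2Circle) :
    ⟪restrictL2 I x, restrictL2 I y⟫_ℂ = ⟪cut I hI x, y⟫_ℂ := by
  rw [inner_eq_integral, L2.inner_def]
  trans ∫ t in I, conj (x t) * y t ∂ell
  · refine integral_congr_ae ?_
    filter_upwards [LpToLpRestrictCLM_coeFn ℂ I x, LpToLpRestrictCLM_coeFn ℂ I y] with t h1 h2
    rw [RCLike.inner_apply, restrictL2, h1, h2, mul_comm]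
  · rw [← integral_indicator₀ hI]
    refine integral_congr_ae ?_
    filter_upwards [coeFn_cut hI x] with t h1
    rw [h1]
    by_cases ht : t ∈ I <;> simp [ht]

theorem norm_restrictL2 (x : L2Circle) : ‖restrictL2 I x‖ = ‖cut I hI x‖ := by
  have h : ⟪restrictL2 I x, restrictL2 I x⟫_ℂ = ⟪cut I hI x, cut I hI x⟫_ℂ := by
    rw [inner_restrictL2 hI, ← cut_cut, inner_cut_left, cut_cut]
  rw [inner_self_eq_norm_sq_to_K, inner_self_eq_norm_sq_to_K] at h
  exact (pow_left_inj₀ (norm_nonneg _) (norm_nonneg _) two_ne_zero).1 (by exact_mod_cast h)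

end Restrict

/-- Extension by zero, made along a measurable set equal to `I` almost everywhere since `I` is only
null measurable. -/
theorem exists_restrictL2_eq {I : Set UCircle} (hI : NullMeasurableSet I ell) (f : L2On I) :
    ∃ F : L2Circle, restrictL2 I F = f := by
  obtain ⟨A, -, hA, hAI⟩ := hI.exists_measurable_superset_ae_eq
  have hres : ell.restrict A = ell.restrict I := Measure.restrict_congr_set hAI
  have hm : MemLp (A.indicator f) 2 ell := by
    rw [memLp_indicator_iff_restrict hA, hres]
    exact Lp.memLp f
  refine ⟨hm.toLp, ?_⟩
  apply Lp.ext
  have h1 : A.indicator f =ᵐ[ell.restrict A] f := indicator_ae_eq_restrict hA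
  rw [hres] at h1
  filter_upwards [LpToLpRestrictCLM_coeFn ℂ I hm.toLp, ae_restrict_of_ae hm.coeFn_toLp, h1]
    with t h2 h3 h4
  rw [restrictL2, h2, h3, h4]

theorem zero_mem_candidates (I : Set UCircle) : (0 : L2Circle) ∈ candidates I := by
  refine ⟨zero_mem _, ae_restrict_of_ae ?_⟩
  filter_upwards [Lp.coeFn_zero ℂ 2 ell] with x hx
  rw [hx]
  simp

theorem add_smul_sub_mem_candidates {I : Set UCircle} {g h : L2Circle} (hg : g ∈ candidates I)
    (hh : h ∈ candidates I) {t : ℝ} (h0 : 0 ≤ t) (h1 : t ≤ 1) :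
    g + (t : ℂ) • (h - g) ∈ candidates I := by
  refine ⟨add_mem hg.1 (Submodule.smul_mem _ _ (sub_mem hh.1 hg.1)), ?_⟩
  filter_upwards [hg.2, hh.2, ae_restrict_of_ae (Lp.coeFn_add g ((t : ℂ) • (h - g))),
    ae_restrict_of_ae (Lp.coeFn_smul (t : ℂ) (h - g)), ae_restrict_of_ae (Lp.coeFn_sub h g)]
    with x hgx hhx h2 h3 h4
  rw [h2, Pi.add_apply, h3, Pi.smul_apply, h4, Pi.sub_apply, smul_eq_mul]
  have : g x + (t : ℂ) * (h x - g x) = ((1 - t : ℝ) : ℂ) * g x + (t : ℂ) * h x := by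
    push_cast; ring
  rw [this]
  refine (norm_add_le _ _).trans ?_
  rw [norm_mul, norm_mul, Complex.norm_real, Complex.norm_real, Real.norm_of_nonneg h0,
    Real.norm_of_nonneg (by linarith)]
  nlinarith

/-- Replaces letting `t → 0` in the first-order optimality condition. -/
theorem nonpos_of_forall_two_mul_le {a b : ℝ} (h : ∀ t : ℝ, 0 < t → t ≤ 1 → 2 * a ≤ t * b) :
    a ≤ 0 := by
  by_contra! ha
  have hb : 0 < b := by linarith [h 1 one_pos le_rfl]
  have h1 := h (min 1 (a / b)) (by positivity) (min_le_left _ _)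
  have h2 : min 1 (a / b) * b ≤ a := by
    calc min 1 (a / b) * b ≤ a / b * b := by gcongr; exact min_le_right _ _
      _ = a := by field_simp
  linarith

/-- The variational inequality characterizing solutions of the bounded extremal problem. -/
theorem IsBEPSolution.re_inner_le_zero {I : Set UCircle} {f : L2On I} {g₀ : L2Circle}
    (h : IsBEPSolution I f g₀) {g : L2Circle} (hg : g ∈ candidates I) :
    RCLike.re ⟪f - restrictL2 I g₀, restrictL2 I g - restrictL2 I g₀⟫_ℂ ≤ 0 := by
  refine nonpos_of_forall_two_mul_le (b := ‖restrictL2 I g - restrictL2 I g₀‖ ^ 2)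
    fun t ht ht1 => ?_
  have h1 : ‖f - restrictL2 I g₀‖ ≤ ‖f - restrictL2 I (g₀ + (t : ℂ) • (g - g₀))‖ :=
    h.2 (add_smul_sub_mem_candidates h.1 hg ht.le ht1)
  have h2 : f - restrictL2 I (g₀ + (t : ℂ) • (g - g₀)) =
      (f - restrictL2 I g₀) - (t : ℂ) • (restrictL2 I g - restrictL2 I g₀) := by
    rw [map_add, map_smul, map_sub]; abel
  rw [h2] at h1
  have h3 := pow_le_pow_left₀ (norm_nonneg _) h1 2
  rw [norm_sub_sq (𝕜 := ℂ) (f - restrictL2 I g₀) ((t : ℂ) • _), inner_smul_right, norm_smul,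
    Complex.norm_real, Real.norm_of_nonneg ht.le] at h3
  have h4 : RCLike.re ((t : ℂ) * ⟪f - restrictL2 I g₀, restrictL2 I g - restrictL2 I g₀⟫_ℂ) =
      t * RCLike.re ⟪f - restrictL2 I g₀, restrictL2 I g - restrictL2 I g₀⟫_ℂ := by
    simp
  rw [h4] at h3
  have h5 : t * (2 * RCLike.re ⟪f - restrictL2 I g₀, restrictL2 I g - restrictL2 I g₀⟫_ℂ) ≤
      t * (t * ‖restrictL2 I g - restrictL2 I g₀‖ ^ 2) := by nlinarith
  exact le_of_mul_le_mul_left h5 ht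

/-- The trace on `I` of the solution is a contraction of the data. -/
theorem IsBEPSolution.norm_restrictL2_sub_le {I : Set UCircle} {f f' : L2On I} {g g' : L2Circle}
    (h : IsBEPSolution I f g) (h' : IsBEPSolution I f' g') :
    ‖restrictL2 I g - restrictL2 I g'‖ ≤ ‖f - f'‖ := by
  have h1 := h.re_inner_le_zero h'.1
  have h2 := h'.re_inner_le_zero h.1
  set p := restrictL2 I g
  set p' := restrictL2 I g'
  -- With both variational inequalities this gives `‖p - p'‖² ≤ re ⟪f - f', p - p'⟫`.
  have h3 : ⟪f - f', p - p'⟫_ℂ = ⟪p - p', p - p'⟫_ℂ - ⟪f - p, p' - p⟫_ℂ - ⟪f' - p', p - p'⟫_ℂ := by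
    simp only [inner_sub_left, inner_sub_right]; ring
  have h4 := congrArg RCLike.re h3
  rw [map_sub, map_sub, inner_self_eq_norm_sq] at h4
  have h5 := re_inner_le_norm (𝕜 := ℂ) (f - f') (p - p')
  by_contra! hlt
  nlinarith [norm_nonneg (f - f')]

/-! ### Duality: the polar of the set of candidates. -/

/-- The sums of a function orthogonal to `H²` and a function vanishing on `I` with `L¹` norm at most
`M`. -/
def polarSum (I : Set UCircle) (M : ℝ) : Set L2Circle :=
  {x | ∃ e q : L2Circle, (∀ y ∈ hardyH2, ⟪y, e⟫_ℂ = 0) ∧ (∀ᵐ t ∂ell, t ∈ I → q t = 0) ∧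
    ∫ t, ‖q t‖ ∂ell ≤ M ∧ x = e + q}

theorem convex_polarSum (I : Set UCircle) (M : ℝ) : Convex ℝ (polarSum I M) := by
  rintro _ ⟨e, q, he, hq, hM, rfl⟩ _ ⟨e', q', he', hq', hM', rfl⟩ a b ha hb hab
  have hae : (a • q + b • q' : L2Circle) =ᵐ[ell] fun t => a • q t + b • q' t := by
    filter_upwards [Lp.coeFn_add (a • q) (b • q'), Lp.coeFn_smul a q, Lp.coeFn_smul b q']
      with t h1 h2 h3
    rw [h1, Pi.add_apply, h2, h3, Pi.smul_apply, Pi.smul_apply]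
  refine ⟨a • e + b • e', a • q + b • q', fun y hy => ?_, ?_, ?_, ?_⟩
  · rw [inner_add_right, inner_smul_right_eq_smul, inner_smul_right_eq_smul, he y hy, he' y hy]
    simp
  · filter_upwards [hae, hq, hq'] with t h1 h2 h3 ht
    rw [h1, h2 ht, h3 ht]
    simp
  · calc ∫ t, ‖(a • q + b • q' : L2Circle) t‖ ∂ell
        ≤ ∫ t, (a * ‖q t‖ + b * ‖q' t‖) ∂ell := by
          refine integral_mono_ae (integrable_coe _).norm
            (((integrable_coe q).norm.const_mul a).add ((integrable_coe q').norm.const_mul b)) ?_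
          filter_upwards [hae] with t h1
          rw [h1]
          refine (norm_add_le _ _).trans ?_
          rw [norm_smul, norm_smul, Real.norm_of_nonneg ha, Real.norm_of_nonneg hb]
      _ = a * (∫ t, ‖q t‖ ∂ell) + b * ∫ t, ‖q' t‖ ∂ell := by
          rw [integral_add ((integrable_coe q).norm.const_mul a)
            ((integrable_coe q').norm.const_mul b), integral_const_mul, integral_const_mul]
      _ ≤ a * M + b * M := by gcongr
      _ = M := by rw [← add_mul, hab, one_mul]
  · rw [smul_add, smul_add]; abel

/-- If `re ⟪g, ·⟫ < u` on the functions carried by the complement of `I` with `L¹` norm at most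
`M`, then `M |g| ≤ u` almost everywhere off `I`. -/
theorem ae_mul_norm_le_of_forall_re_inner_lt {I : Set UCircle} (hI : NullMeasurableSet I ell)
    {M u : ℝ} (hM : 0 < M) {g : L2Circle}
    (h : ∀ q : L2Circle, (∀ᵐ t ∂ell, t ∈ I → q t = 0) → ∫ t, ‖q t‖ ∂ell ≤ M →
      RCLike.re ⟪g, q⟫_ℂ < u) :
    ∀ᵐ t ∂ell, t ∉ I → M * ‖g t‖ ≤ u := by
  set B : Set UCircle := {t | u < M * ‖g t‖} ∩ Iᶜ
  have hgm : StronglyMeasurable g := Lp.stronglyMeasurable g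
  have hB : NullMeasurableSet B ell :=
    (measurableSet_lt measurable_const (hgm.norm.measurable.const_mul M)).nullMeasurableSet.inter
      hI.compl
  suffices hB0 : ell B = 0 by
    filter_upwards [measure_eq_zero_iff_ae_notMem.1 hB0] with t ht htI
    by_contra! hlt
    exact ht ⟨hlt, htI⟩
  by_contra hB0
  have hBpos : 0 < ell.real B := ENNReal.toReal_pos hB0 (measure_ne_top _ _)
  -- The test function is `c` times the phase of `g` on `B`, with `c` normalizing its `L¹` norm to
  -- at most `M`; its pairing with `g` is then at least `u`. At zeros of `g` the quotient below is
  -- `0` by convention.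
  set c : ℝ := M / ell.real B
  have hc : 0 < c := by positivity
  have hunit : ∀ t, ‖g t / (‖g t‖ : ℂ)‖ ≤ 1 := fun t => by
    rw [norm_div, Complex.norm_real, norm_norm]
    exact div_self_le_one _
  have hmeas : AEStronglyMeasurable (fun t => (c : ℂ) * (g t / (‖g t‖ : ℂ))) ell := by
    have : Measurable fun t => (c : ℂ) * (g t / (‖g t‖ : ℂ)) :=
      measurable_const.mul (hgm.measurable.div (Complex.measurable_ofReal.comp hgm.norm.measurable))
    exact this.aestronglyMeasurable
  have hle : ∀ t, ‖B.indicator (fun t => (c : ℂ) * (g t / (‖g t‖ : ℂ))) t‖ ≤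
      B.indicator (fun _ => c) t := fun t => by
    by_cases ht : t ∈ B
    · rw [Set.indicator_of_mem ht, Set.indicator_of_mem ht, norm_mul, Complex.norm_real,
        Real.norm_of_nonneg hc.le]
      exact mul_le_of_le_one_right hc.le (hunit t)
    · simp [ht]
  have hq : MemLp (B.indicator fun t => (c : ℂ) * (g t / (‖g t‖ : ℂ))) 2 ell :=
    MemLp.of_bound (hmeas.indicator₀ hB) c (ae_of_all _ fun t => (hle t).trans
      (Set.indicator_le_self' (fun _ _ => hc.le) t))
  obtain ⟨q, hqae⟩ : ∃ q : L2Circle,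
      q =ᵐ[ell] B.indicator fun t => (c : ℂ) * (g t / (‖g t‖ : ℂ)) := ⟨hq.toLp, hq.coeFn_toLp⟩
  have hlt := h q ?_ ?_
  · have hin : ⟪g, q⟫_ℂ = ((∫ t in B, c * ‖g t‖ ∂ell : ℝ) : ℂ) := by
      rw [inner_eq_integral, ← integral_indicator₀ hB, ← integral_complex_ofReal]
      refine integral_congr_ae ?_
      filter_upwards [hqae] with t ht
      rw [ht]
      by_cases htB : t ∈ B
      · rw [Set.indicator_of_mem htB, Set.indicator_of_mem htB]
        by_cases h0 : ‖g t‖ = 0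
        · rw [norm_eq_zero.1 h0]; simp
        · have h0' : (‖g t‖ : ℂ) ≠ 0 := by exact_mod_cast h0
          have h1 : conj (g t) * g t = (‖g t‖ : ℂ) ^ 2 := Complex.conj_mul' _
          push_cast
          field_simp
          rw [← h1]
          ring
      · simp [htB]
    rw [hin, RCLike.re_eq_complex_re, Complex.ofReal_re] at hlt
    have h1 : ∫ _ in B, c * (u / M) ∂ell ≤ ∫ t in B, c * ‖g t‖ ∂ell := by
      refine setIntegral_mono_on₀ (integrable_const _).integrableOn
        ((integrable_coe g).norm.const_mul c).integrableOn hB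
        fun t ht => ?_
      have h2 : u < M * ‖g t‖ := ht.1
      have h3 : u / M ≤ ‖g t‖ := by rw [div_le_iff₀ hM]; linarith
      gcongr
    rw [setIntegral_const, smul_eq_mul] at h1
    have h2 : ell.real B * (c * (u / M)) = u := by
      simp only [c]; field_simp
    linarith
  · filter_upwards [hqae] with t ht htI
    rw [ht]
    exact Set.indicator_of_notMem (fun hB => hB.2 htI) _
  · calc ∫ t, ‖q t‖ ∂ell ≤ ∫ t, B.indicator (fun _ => c) t ∂ell := by
          refine integral_mono_ae (integrable_coe _).norm ((integrable_const c).indicator₀ hB) ?_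
          filter_upwards [hqae] with t ht
          rw [ht]
          exact hle t
      _ = M := by
          rw [integral_indicator₀ hB, setIntegral_const, smul_eq_mul]
          simp only [c]; field_simp

/-- If `re ⟪D, g⟫ ≤ M` for all candidates `g`, then `D` is in the closure of the sums of functions
orthogonal to `H²` and functions carried by the complement of `I` of `L¹` norm at most `M' > M`. -/
theorem mem_closure_polarSum {I : Set UCircle} (hI : NullMeasurableSet I ell) {D : L2Circle}
    {M M' : ℝ} (hM : 0 ≤ M) (hMM' : M < M')
    (hD : ∀ g ∈ candidates I, RCLike.re ⟪D, g⟫_ℂ ≤ M) : D ∈ closure (polarSum I M') := by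
  -- Even for `M = 0` the `L¹` ball is nontrivial, so the separating functional is controlled off
  -- `I`.
  have hM' : 0 < M' := hM.trans_lt hMM'
  have hzero : ∀ᵐ t ∂ell, t ∈ I → (0 : L2Circle) t = 0 := by
    filter_upwards [Lp.coeFn_zero ℂ 2 ell] with t ht _
    exact ht
  have hzero' : ∫ t, ‖(0 : L2Circle) t‖ ∂ell ≤ M' := by
    have := integral_norm_le_norm (0 : L2Circle)
    rw [norm_zero] at this
    linarith
  by_contra hnot
  obtain ⟨Λ, u, hlt, hu⟩ := RCLike.geometric_hahn_banach_closed_point (𝕜 := ℂ)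
    (convex_polarSum I M').closure isClosed_closure hnot
  set g := (InnerProductSpace.toDual ℂ L2Circle).symm Λ
  have hΛ : ∀ x, Λ x = ⟪g, x⟫_ℂ := fun x => (InnerProductSpace.toDual_symm_apply).symm
  simp only [hΛ] at hlt hu
  have hlt' : ∀ x ∈ polarSum I M', RCLike.re ⟪g, x⟫_ℂ < u := fun x hx => hlt x (subset_closure hx)
  have hu0 : 0 < u := by
    have := hlt' 0 ⟨0, 0, by simp, hzero, hzero', by simp⟩
    simpa using this
  have hgH : g ∈ hardyH2 := by
    refine mem_hardyH2_iff.2 fun n hn => ?_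
    rw [← inner_conj_symm, map_eq_zero]
    by_contra hne
    set s := ⟪g, zpow n⟫_ℂ
    have hs : s * conj s = ((‖s‖ ^ 2 : ℝ) : ℂ) := by
      rw [Complex.mul_conj, Complex.normSq_eq_norm_sq]
    have hspos : 0 < ‖s‖ ^ 2 := by positivity
    -- A functional bounded above on a linear subspace vanishes there; this multiple would reach the
    -- value `u` exactly.
    have := hlt' (((u / ‖s‖ ^ 2 : ℝ) : ℂ) • conj s • zpow n)
      ⟨_, 0, fun y hy => ?_, hzero, hzero', (add_zero _).symm⟩
    · rw [inner_smul_right, inner_smul_right, mul_comm (conj s), hs, ← Complex.ofReal_mul,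
        RCLike.re_eq_complex_re, Complex.ofReal_re, div_mul_cancel₀ _ hspos.ne'] at this
      exact lt_irrefl _ this
    · rw [inner_smul_right, inner_smul_right, ← inner_conj_symm, mem_hardyH2_iff.1 hy n hn]
      simp
  have hgJ := ae_mul_norm_le_of_forall_re_inner_lt hI hM' (g := g) (u := u) fun q hq hq' =>
    hlt' q ⟨0, q, by simp, hq, hq', (zero_add q).symm⟩
  -- Rescaled to be a candidate, the separating vector pairs with `D` to more than `M'`.
  have hcand : ((M' / u : ℝ) : ℂ) • g ∈ candidates I := by
    refine ⟨Submodule.smul_mem _ _ hgH, ?_⟩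
    rw [ae_restrict_iff'₀ hI.compl]
    filter_upwards [hgJ, Lp.coeFn_smul ((M' / u : ℝ) : ℂ) g] with t h1 h2 ht
    rw [h2, Pi.smul_apply, norm_smul, Complex.norm_real, Real.norm_of_nonneg (by positivity),
      div_mul_eq_mul_div, div_le_one hu0]
    exact h1 ht
  have h1 := hD _ hcand
  rw [inner_smul_right, RCLike.re_eq_complex_re, Complex.re_ofReal_mul,
    ← RCLike.re_eq_complex_re, inner_re_symm] at h1
  have h2 : M' < M' / u * RCLike.re ⟪g, D⟫_ℂ := by
    rw [div_mul_eq_mul_div, lt_div_iff₀ hu0]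
    exact mul_lt_mul_of_pos_left hu hM'
  linarith

/-! ### Testing against continuous functions and localization on the interior of `I`. -/

theorem integral_fourier_mul_eq_inner (n : ℤ) (x : L2Circle) :
    ∫ t, fourier n t * x t ∂ell = ⟪zpow (-n), x⟫_ℂ := by
  rw [inner_eq_integral]
  refine integral_congr_ae ?_
  filter_upwards [coeFn_zpow (-n)] with t h1
  rw [h1, fourier_neg, Complex.conj_conj]

theorem integrable_continuousMap_mul (c : C(UCircle, ℂ)) (x : L2Circle) :
    Integrable (fun t => c t * x t) ell :=
  (integrable_coe x).bdd_mul c.continuous.aestronglyMeasurable (ae_of_all _ c.norm_coe_le_norm)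

/-- Convergence to zero of all Fourier coefficients and boundedness in `L¹` imply convergence of the
integrals against continuous functions. -/
theorem tendsto_integral_continuousMap_mul {e : ℕ → L2Circle} {C : ℝ}
    (hC : ∀ n, ∫ x, ‖e n x‖ ∂ell ≤ C)
    (he : ∀ k : ℤ, Tendsto (fun n => ⟪zpow k, e n⟫_ℂ) atTop (𝓝 0)) (c : C(UCircle, ℂ)) :
    Tendsto (fun n => ∫ t, c t * e n t ∂ell) atTop (𝓝 0) := by
  have hC0 : 0 ≤ C := (integral_nonneg fun _ => norm_nonneg _).trans (hC 0)
  let W : Submodule ℂ C(UCircle, ℂ) :=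
    { carrier := {c | Tendsto (fun n => ∫ t, c t * e n t ∂ell) atTop (𝓝 0)}
      add_mem' := fun {a b} ha hb => by
        have := Tendsto.add ha hb
        rw [add_zero] at this
        refine this.congr fun n => ?_
        rw [← integral_add (integrable_continuousMap_mul a _) (integrable_continuousMap_mul b _)]
        simp only [ContinuousMap.add_apply, add_mul]
      zero_mem' := by simp
      smul_mem' := fun s a ha => by
        have := Tendsto.const_mul s ha
        rw [mul_zero] at this
        refine this.congr fun n => ?_
        rw [← integral_const_mul]
        simp only [ContinuousMap.smul_apply, smul_eq_mul, mul_assoc] }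
  have hspan : Submodule.span ℂ (Set.range (@fourier (2 * Real.pi))) ≤ W := by
    rw [Submodule.span_le]
    rintro _ ⟨n, rfl⟩
    exact (he (-n)).congr fun k => (integral_fourier_mul_eq_inner n (e k)).symm
  have hc : c ∈ closure (W : Set C(UCircle, ℂ)) := by
    have h1 : c ∈ (Submodule.span ℂ (Set.range (@fourier (2 * Real.pi)))).topologicalClosure := by
      rw [span_fourier_closure_eq_top]; trivial
    exact closure_mono hspan h1
  rw [Metric.tendsto_atTop]
  intro ε hε
  obtain ⟨ψ, hψ, hdist⟩ := Metric.mem_closure_iff.1 hc (ε / (2 * (C + 1))) (by positivity)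
  obtain ⟨N, hN⟩ := Metric.tendsto_atTop.1
    (show Tendsto (fun n => ∫ t, ψ t * e n t ∂ell) atTop (𝓝 0) from hψ) (ε / 2) (by positivity)
  refine ⟨N, fun n hn => ?_⟩
  have h1 := hN n hn
  rw [dist_zero_right] at h1 ⊢
  rw [dist_eq_norm] at hdist
  have h2 : ∫ t, c t * e n t ∂ell =
      (∫ t, (c - ψ) t * e n t ∂ell) + ∫ t, ψ t * e n t ∂ell := by
    rw [← integral_add (integrable_continuousMap_mul (c - ψ) _) (integrable_continuousMap_mul ψ _)]
    simp only [ContinuousMap.sub_apply, ← add_mul, sub_add_cancel]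
  have h3 : ‖∫ t, (c - ψ) t * e n t ∂ell‖ ≤ ε / (2 * (C + 1)) * C := by
    calc ‖∫ t, (c - ψ) t * e n t ∂ell‖ ≤ ∫ t, ‖(c - ψ) t * e n t‖ ∂ell :=
          norm_integral_le_integral_norm _
      _ ≤ ∫ t, ε / (2 * (C + 1)) * ‖e n t‖ ∂ell := by
          refine integral_mono (integrable_continuousMap_mul (c - ψ) _).norm
            ((integrable_coe (e n)).norm.const_mul _) fun t => ?_
          simp only [norm_mul]
          exact mul_le_mul_of_nonneg_right (((c - ψ).norm_coe_le_norm t).trans hdist.le)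
            (norm_nonneg _)
      _ = ε / (2 * (C + 1)) * ∫ t, ‖e n t‖ ∂ell := integral_const_mul _ _
      _ ≤ _ := by gcongr; exact hC n
  have h4 : ε / (2 * (C + 1)) * C ≤ ε / 2 := by
    rw [div_mul_eq_mul_div, div_le_div_iff₀ (by positivity) (by positivity)]
    nlinarith
  rw [h2]
  exact (norm_add_le _ _).trans_lt (by linarith)

theorem tendsto_integral_continuousMap_mul_of_tendsto {x : ℕ → L2Circle} {D : L2Circle}
    (hx : Tendsto x atTop (𝓝 D)) (c : C(UCircle, ℂ)) :
    Tendsto (fun n => ∫ t, c t * x n t ∂ell) atTop (𝓝 (∫ t, c t * D t ∂ell)) := by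
  have hm : MemLp (fun t => conj (c t)) 2 ell :=
    MemLp.of_bound (by fun_prop) ‖c‖ (ae_of_all _ fun x => by
      rw [RCLike.norm_conj]; exact c.norm_coe_le_norm x)
  have h : ∀ y : L2Circle, ∫ t, c t * y t ∂ell = ⟪hm.toLp, y⟫_ℂ := by
    intro y
    rw [inner_eq_integral]
    refine integral_congr_ae ?_
    filter_upwards [hm.coeFn_toLp] with t ht
    rw [ht, Complex.conj_conj]
  simp only [h]
  exact tendsto_const_nhds.inner hx

/-- If functions `e n` whose Fourier coefficients tend to zero are bounded in `L¹`, the functions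
`q n` vanish on `I`, and `e n + q n → D` in `L²`, then `D` vanishes on the interior of `I`. -/
theorem ae_eq_zero_on_interior {I : Set UCircle} (hne : (Iᶜ).Nonempty) {e q : ℕ → L2Circle}
    {D : L2Circle} {C : ℝ} (hC : ∀ n, ∫ x, ‖e n x‖ ∂ell ≤ C)
    (he : ∀ k : ℤ, Tendsto (fun n => ⟪zpow k, e n⟫_ℂ) atTop (𝓝 0))
    (hq : ∀ n, ∀ᵐ t ∂ell, t ∈ I → q n t = 0)
    (hlim : Tendsto (fun n => e n + q n) atTop (𝓝 D)) :
    ∀ᵐ t ∂ell, t ∈ interior I → D t = 0 := by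
  -- The cutoff `ψ` is the distance to this set; the distance to an empty set would be `0` by
  -- convention.
  have hneU : ((interior I)ᶜ).Nonempty := hne.mono (Set.compl_subset_compl.2 interior_subset)
  let ψ : C(UCircle, ℂ) :=
    ⟨fun t => (Metric.infDist t (interior I)ᶜ : ℂ),
      Complex.continuous_ofReal.comp (Metric.continuous_infDist_pt _)⟩
  have hψI : ∀ t, t ∉ I → ψ t = 0 := fun t ht => by
    have : Metric.infDist t (interior I)ᶜ = 0 :=
      Metric.infDist_zero_of_mem fun h => ht (interior_subset h)
    simp [ψ, this]
  have hψD : (fun t => ψ t * D t) =ᵐ[ell] 0 := by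
    refine ae_eq_zero_of_forall_integral_fourier_mul (integrable_continuousMap_mul ψ D) fun k => ?_
    obtain ⟨c, hc⟩ : ∃ c : C(UCircle, ℂ), ∀ t, c t = fourier k t * ψ t :=
      ⟨fourier k * ψ, fun _ => rfl⟩
    have h1 := tendsto_integral_continuousMap_mul_of_tendsto hlim c
    have h2 := tendsto_integral_continuousMap_mul hC he c
    have h3 : ∀ n, ∫ t, c t * (e n + q n : L2Circle) t ∂ell =
        ∫ t, c t * e n t ∂ell := by
      intro n
      refine integral_congr_ae ?_
      filter_upwards [hq n, Lp.coeFn_add (e n) (q n)] with t h4 h5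
      rw [h5, Pi.add_apply]
      by_cases ht : t ∈ I
      · rw [h4 ht, add_zero]
      · simp only [hc, hψI t ht, mul_zero, zero_mul]
    simp only [h3] at h1
    have h4 := tendsto_nhds_unique h1 h2
    simpa only [hc, mul_assoc] using h4
  filter_upwards [hψD] with t ht htU
  refine (mul_eq_zero.1 ht).resolve_left ?_
  have hpos : 0 < Metric.infDist t (interior I)ᶜ :=
    (isOpen_interior.isClosed_compl.notMem_iff_infDist_pos hneU).1 (fun h => h htU)
  change (Metric.infDist t (interior I)ᶜ : ℂ) ≠ 0
  exact_mod_cast hpos.ne'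

/-! ### Saturation of the constraint. -/

/-- If `q` vanishes on `I`, then its mass on a set where a candidate has modulus at most `1 - ε` is
controlled by the defect in `re ⟪q, g⟫ ≤ ‖q‖₁`. -/
theorem mul_setIntegral_norm_le {I E : Set UCircle} (hI : NullMeasurableSet I ell)
    (hE : NullMeasurableSet E ell) {ε : ℝ} {g q : L2Circle} (hg : g ∈ candidates I)
    (hgE : ∀ t ∈ E, ‖g t‖ ≤ 1 - ε) (hq : ∀ᵐ t ∂ell, t ∈ I → q t = 0) :
    ε * ∫ t in E, ‖q t‖ ∂ell ≤ (∫ t, ‖q t‖ ∂ell) - RCLike.re ⟪q, g⟫_ℂ := by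
  have hqi := (integrable_coe q).norm
  have hre : RCLike.re ⟪q, g⟫_ℂ = ∫ t, RCLike.re (conj (q t) * g t) ∂ell := by
    rw [inner_eq_integral]
    exact (integral_re (integrable_conj_mul q g)).symm
  rw [hre, ← integral_sub hqi (integrable_conj_mul q g).re, ← integral_indicator₀ hE,
    ← integral_const_mul]
  have hgJ := hg.2
  rw [ae_restrict_iff'₀ hI.compl] at hgJ
  refine integral_mono_ae ((hqi.indicator₀ hE).const_mul ε)
    (hqi.sub (integrable_conj_mul q g).re) ?_
  filter_upwards [hq, hgJ] with t h1 h2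
  have h3 : RCLike.re (conj (q t) * g t) ≤ ‖q t‖ * ‖g t‖ := by
    refine (RCLike.re_le_norm _).trans ?_
    rw [norm_mul, RCLike.norm_conj]
  by_cases htE : t ∈ E
  · rw [Set.indicator_of_mem htE]
    nlinarith [hgE t htE, norm_nonneg (q t)]
  · rw [Set.indicator_of_notMem htE, mul_zero, sub_nonneg]
    refine h3.trans ?_
    by_cases htI : t ∈ I
    · rw [h1 htI, norm_zero, zero_mul]
    · exact mul_le_of_le_one_right (norm_nonneg _) (h2 htI)

/-- If the solution has modulus at most `1 - ε` on a subset of the complement of `I` of positive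
measure, then it interpolates the data. -/
theorem IsBEPSolution.restrictL2_eq {I E : Set UCircle} (hI : NullMeasurableSet I ell)
    (hfr : ell (frontier I) = 0) {f : L2On I} {g₀ : L2Circle} (h : IsBEPSolution I f g₀)
    (hE : NullMeasurableSet E ell) (hEpos : 0 < ell E) (hEI : E ⊆ Iᶜ) {ε : ℝ} (hε : 0 < ε)
    (hgE : ∀ t ∈ E, ‖g₀ t‖ ≤ 1 - ε) : restrictL2 I g₀ = f := by
  obtain ⟨F, rfl⟩ := exists_restrictL2_eq hI f
  set D := cut I hI (F - g₀)
  have hDI : ∀ᵐ t ∂ell, t ∉ I → D t = 0 := by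
    filter_upwards [coeFn_cut hI (F - g₀)] with t ht htI
    rw [ht]
    exact Set.indicator_of_notMem htI _
  have hDg : ∀ g, ⟪D, g⟫_ℂ = ⟪restrictL2 I F - restrictL2 I g₀, restrictL2 I g⟫_ℂ := fun g => by
    rw [← map_sub, inner_restrictL2 hI]
  set M := RCLike.re ⟪D, g₀⟫_ℂ
  have hDM : ∀ g ∈ candidates I, RCLike.re ⟪D, g⟫_ℂ ≤ M := fun g hg => by
    have := h.re_inner_le_zero hg
    rw [inner_sub_right, map_sub, ← hDg, ← hDg] at this
    linarith
  have hM : 0 ≤ M := by simpa using hDM 0 (zero_mem_candidates I)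
  have hex : ∀ n : ℕ, ∃ e q : L2Circle, (∀ y ∈ hardyH2, ⟪y, e⟫_ℂ = 0) ∧
      (∀ᵐ t ∂ell, t ∈ I → q t = 0) ∧ ∫ t, ‖q t‖ ∂ell ≤ M + 1 / (n + 1 : ℝ) ∧
      ‖e + q - D‖ ≤ 1 / (n + 1 : ℝ) := by
    intro n
    have hn : (0 : ℝ) < 1 / (n + 1 : ℝ) := by positivity
    obtain ⟨x, ⟨e, q, he, hq, hqM, rfl⟩, hd⟩ := Metric.mem_closure_iff.1
      (mem_closure_polarSum hI hM (lt_add_of_pos_right M hn) hDM) _ hn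
    refine ⟨e, q, he, hq, hqM, ?_⟩
    rw [← dist_eq_norm, dist_comm]
    exact hd.le
  choose e q he hq hqM hd using hex
  have hsmall : Tendsto (fun n : ℕ => 1 / (n + 1 : ℝ)) atTop (𝓝 0) :=
    tendsto_one_div_add_atTop_nhds_zero_nat
  have hle1 : ∀ n : ℕ, 1 / (n + 1 : ℝ) ≤ 1 := fun n => by
    rw [div_le_one (by positivity)]
    linarith [n.cast_nonneg (α := ℝ)]
  have hlim : Tendsto (fun n => e n + q n) atTop (𝓝 D) :=
    tendsto_iff_norm_sub_tendsto_zero.2 (squeeze_zero (fun _ => norm_nonneg _) hd hsmall)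
  -- `e n` is orthogonal to `g₀`, so `q n` alone carries the limiting value; its mass exceeds `M` by
  -- at most `1 / (n + 1)`, and the defect tends to zero.
  have hqg : Tendsto (fun n => RCLike.re ⟪q n, g₀⟫_ℂ) atTop (𝓝 M) := by
    have h1 : Tendsto (fun n => RCLike.re ⟪e n + q n, g₀⟫_ℂ) atTop (𝓝 M) :=
      (RCLike.continuous_re.tendsto _).comp (hlim.inner tendsto_const_nhds)
    refine h1.congr fun n => ?_
    rw [inner_add_left, ← inner_conj_symm, he n g₀ h.1.1, map_zero, zero_add]
  have hqE : Tendsto (fun n => ∫ t in E, ‖q n t‖ ∂ell) atTop (𝓝 0) := by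
    have h1 : Tendsto (fun n : ℕ => ε⁻¹ * (M + 1 / (n + 1 : ℝ) - RCLike.re ⟪q n, g₀⟫_ℂ))
        atTop (𝓝 0) := by
      simpa using ((tendsto_const_nhds (x := M)).add hsmall |>.sub hqg).const_mul ε⁻¹
    refine squeeze_zero (fun n => integral_nonneg fun _ => norm_nonneg _) (fun n => ?_) h1
    rw [le_inv_mul_iff₀ hε]
    have := mul_setIntegral_norm_le hI hE h.1 hgE (hq n)
    linarith [hqM n]
  have hesub : ∀ n, ∀ᵐ t ∂ell, e n t = (e n + q n - D : L2Circle) t + D t - q n t := by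
    intro n
    filter_upwards [Lp.coeFn_sub (e n + q n) D, Lp.coeFn_add (e n) (q n)] with t h1 h2
    rw [h1, Pi.sub_apply, h2, Pi.add_apply]
    ring
  -- `D` vanishes on `E`, so there `e n` is `-q n` up to an error small in `L²`.
  have heE : Tendsto (fun n => ∫ t in E, ‖e n t‖ ∂ell) atTop (𝓝 0) := by
    have h1 : Tendsto (fun n : ℕ => 1 / (n + 1 : ℝ) + ∫ t in E, ‖q n t‖ ∂ell) atTop (𝓝 0) := by
      simpa using hsmall.add hqE
    refine squeeze_zero (fun n => integral_nonneg fun _ => norm_nonneg _) (fun n => ?_) h1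
    have hi := (integrable_coe (e n + q n - D)).norm
    have hiq := (integrable_coe (q n)).norm
    calc ∫ t in E, ‖e n t‖ ∂ell
        ≤ ∫ t in E, (‖(e n + q n - D : L2Circle) t‖ + ‖q n t‖) ∂ell := by
          refine integral_mono_ae (integrable_coe (e n)).norm.integrableOn
            (hi.add hiq).integrableOn ?_
          rw [EventuallyLE, ae_restrict_iff'₀ hE]
          filter_upwards [hesub n, hDI] with t h2 h3 htE
          rw [h2, h3 (hEI htE), add_zero]
          exact norm_sub_le _ _
      _ = (∫ t in E, ‖(e n + q n - D : L2Circle) t‖ ∂ell) + ∫ t in E, ‖q n t‖ ∂ell :=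
          integral_add hi.integrableOn hiq.integrableOn
      _ ≤ _ := by
          gcongr
          exact (setIntegral_le_integral hi (ae_of_all _ fun _ => norm_nonneg _)).trans
            ((integral_norm_le_norm _).trans (hd n))
  have heC : ∀ n, ∫ t, ‖e n t‖ ∂ell ≤ 1 + ‖D‖ + (M + 1) := by
    intro n
    have hi := (integrable_coe (e n + q n - D)).norm
    have hiD := (integrable_coe D).norm
    have hiq := (integrable_coe (q n)).norm
    calc ∫ t, ‖e n t‖ ∂ell
        ≤ ∫ t, (‖(e n + q n - D : L2Circle) t‖ + ‖D t‖ + ‖q n t‖) ∂ell := by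
          refine integral_mono_ae (integrable_coe (e n)).norm ((hi.add hiD).add hiq) ?_
          filter_upwards [hesub n] with t h2
          rw [h2]
          exact (norm_sub_le _ _).trans (add_le_add_left (norm_add_le _ _) _)
      _ = (∫ t, ‖(e n + q n - D : L2Circle) t‖ ∂ell) + (∫ t, ‖D t‖ ∂ell) +
          ∫ t, ‖q n t‖ ∂ell := by
          rw [← integral_add hi hiD]
          exact integral_add (hi.add hiD) hiq
      _ ≤ _ := by
          have h1 := (integral_norm_le_norm (e n + q n - D)).trans (hd n)
          have h2 := integral_norm_le_norm D
          linarith [hqM n, hle1 n]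
  have hne : (Iᶜ).Nonempty := (nonempty_of_measure_ne_zero hEpos.ne').mono hEI
  have hint := ae_eq_zero_on_interior hne heC
    (tendsto_inner_zpow_zero hE hEpos he heC heE) hq hlim
  have hD0 : D = 0 := by
    apply Lp.ext
    filter_upwards [hint, hDI, measure_eq_zero_iff_ae_notMem.1 hfr, Lp.coeFn_zero ℂ 2 ell]
      with t h1 h2 h3 h4
    rw [h4, Pi.zero_apply]
    by_cases ht : t ∈ I
    · exact h1 (by_contra fun h5 => h3 ⟨subset_closure ht, h5⟩)
    · exact h2 ht
  have h1 := norm_restrictL2 hI (F - g₀)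
  rw [show cut I hI (F - g₀) = 0 from hD0, norm_zero, norm_eq_zero, map_sub, sub_eq_zero] at h1
  exact h1.symm

/-- The constraint is saturated: unless the data is the trace of a candidate of modulus less than
`1` on a set of positive measure, the solution is unimodular off `I`. -/
theorem IsBEPSolution.one_le_norm {I : Set UCircle} (hI : NullMeasurableSet I ell)
    (hfr : ell (frontier I) = 0) {f : L2On I} {g₀ : L2Circle} (h : IsBEPSolution I f g₀)
    (hf : ¬ ∃ g : L2Circle, g ∈ hardyH2 ∧ restrictL2 I g = f ∧
      (∀ᵐ x ∂(ell.restrict Iᶜ), ‖g x‖ ≤ 1) ∧ 0 < ell.restrict Iᶜ {x | ‖g x‖ < 1}) :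
    ∀ᵐ t ∂ell, t ∉ I → 1 ≤ ‖g₀ t‖ := by
  have hgm : StronglyMeasurable g₀ := Lp.stronglyMeasurable g₀
  by_cases hpos : 0 < ell.restrict Iᶜ {x | ‖g₀ x‖ < 1}
  · exfalso
    refine hf ⟨g₀, h.1.1, ?_, h.1.2, hpos⟩
    -- These sets exhaust the part of the complement where `|g₀| < 1`, so one of them has positive
    -- measure.
    let E : ℕ → Set UCircle := fun k => {x | ‖g₀ x‖ ≤ 1 - 1 / (k + 1 : ℝ)} ∩ Iᶜ
    have hE : ∀ k, NullMeasurableSet (E k) ell := fun k =>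
      (measurableSet_le hgm.norm.measurable measurable_const).nullMeasurableSet.inter hI.compl
    have hex : ∃ k, ell (E k) ≠ 0 := by
      by_contra! hall
      rw [Measure.restrict_apply (measurableSet_lt hgm.norm.measurable measurable_const)] at hpos
      refine hpos.ne' (measure_mono_null ?_ (measure_iUnion_null hall))
      rintro x ⟨hx, hxI⟩
      obtain ⟨k, hk⟩ := exists_nat_one_div_lt (sub_pos.2 (show ‖g₀ x‖ < 1 from hx))
      exact Set.mem_iUnion.2 ⟨k, show ‖g₀ x‖ ≤ 1 - 1 / (k + 1 : ℝ) by linarith, hxI⟩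
    obtain ⟨k, hk⟩ := hex
    exact h.restrictL2_eq hI hfr (hE k) (pos_iff_ne_zero.2 hk) Set.inter_subset_right
      (ε := 1 / (k + 1 : ℝ)) (by positivity) fun t ht => ht.1
  · have h0 : ell.restrict Iᶜ {x | ‖g₀ x‖ < 1} = 0 := by simpa using hpos
    have h1 := measure_eq_zero_iff_ae_notMem.1 h0
    rw [ae_restrict_iff'₀ hI.compl] at h1
    filter_upwards [h1] with t ht htI
    exact not_lt.1 (ht htI)

/-! ### Strong convergence and the theorem. -/

/-- Weak convergence together with an inequality of norms gives strong convergence. -/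
theorem tendsto_zero_of_norm_le_of_inner {a : L2Circle} {b : ℕ → L2Circle}
    (hb : ∀ n, ‖b n‖ ≤ ‖a‖) (h : Tendsto (fun n => ⟪a, b n - a⟫_ℂ) atTop (𝓝 0)) :
    Tendsto (fun n => b n - a) atTop (𝓝 0) := by
  have h1 : Tendsto (fun n => -2 * RCLike.re ⟪a, b n - a⟫_ℂ) atTop (𝓝 0) := by
    have := ((RCLike.continuous_re.tendsto (0 : ℂ)).comp h).const_mul (-2)
    rwa [map_zero, mul_zero] at this
  have h2 : Tendsto (fun n => ‖b n - a‖ ^ 2) atTop (𝓝 0) := by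
    refine squeeze_zero (fun n => by positivity) (fun n => ?_) h1
    -- Expanding with `‖b n‖ ≤ ‖a‖` gives `‖b n - a‖² ≤ 2 ‖a‖² - 2 re ⟪a, b n⟫`.
    rw [norm_sub_sq (𝕜 := ℂ), inner_sub_right, map_sub, inner_self_eq_norm_sq, inner_re_symm a]
    nlinarith [pow_le_pow_left₀ (norm_nonneg _) (hb n) 2]
  have h3 := (Real.continuous_sqrt.tendsto 0).comp h2
  rw [Real.sqrt_zero] at h3
  refine tendsto_zero_iff_norm_tendsto_zero.2 (h3.congr fun n => ?_)
  exact Real.sqrt_sq (norm_nonneg _)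

end

end HardyBEP

theorem mainTheorem6 (I : Set HardyBEP.UCircle)
    (hImeas : NullMeasurableSet I HardyBEP.ell)
    (hI : 0 < HardyBEP.ell I) (hJ : 0 < HardyBEP.ell Iᶜ)
    (f : HardyBEP.L2On I) (fseq : ℕ → HardyBEP.L2On I)
    (hf : Tendsto fseq atTop (𝓝 f))
    (g₀ : HardyBEP.L2Circle) (gseq : ℕ → HardyBEP.L2Circle)
    (hg₀ : HardyBEP.IsBEPSolution I f g₀)
    (hgseq : ∀ n, HardyBEP.IsBEPSolution I (fseq n) (gseq n)) :
    Tendsto (fun n => HardyBEP.restrictL2 I (gseq n)) atTop (𝓝 (HardyBEP.restrictL2 I g₀)) ∧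
    HardyBEP.WeakStarTendstoLinfty Iᶜ (fun n x => gseq n x) (fun x => g₀ x) ∧
    (HardyBEP.ell (frontier I) = 0 →
      (¬ ∃ g : HardyBEP.L2Circle, g ∈ HardyBEP.hardyH2 ∧ HardyBEP.restrictL2 I g = f ∧
          (∀ᵐ x ∂(HardyBEP.ell.restrict Iᶜ), ‖g x‖ ≤ 1) ∧
          0 < HardyBEP.ell.restrict Iᶜ {x | ‖g x‖ < 1}) →
      Tendsto gseq atTop (𝓝 g₀)) := by
  have hlip : ∀ n, ‖HardyBEP.restrictL2 I (gseq n) - HardyBEP.restrictL2 I g₀‖ ≤ ‖fseq n - f‖ :=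
    fun n => (hgseq n).norm_restrictL2_sub_le hg₀
  have hf0 : Tendsto (fun n => ‖fseq n - f‖) atTop (𝓝 0) := tendsto_iff_norm_sub_tendsto_zero.1 hf
  have hcutle : ∀ n, ‖HardyBEP.cut I hImeas (gseq n - g₀)‖ ≤ ‖fseq n - f‖ := fun n => by
    rw [← HardyBEP.norm_restrictL2, map_sub]
    exact hlip n
  have hcut : Tendsto (fun n => HardyBEP.cut I hImeas (gseq n - g₀)) atTop (𝓝 0) :=
    tendsto_zero_iff_norm_tendsto_zero.2 (squeeze_zero (fun _ => norm_nonneg _) hcutle hf0)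
  have hbd : ∀ n, ∀ᵐ x ∂(HardyBEP.ell.restrict Iᶜ), ‖(gseq n - g₀ : HardyBEP.L2Circle) x‖ ≤ 2 := by
    intro n
    filter_upwards [hg₀.1.2, (hgseq n).1.2, ae_restrict_of_ae (Lp.coeFn_sub (gseq n) g₀)]
      with x h1 h2 h3
    rw [h3, Pi.sub_apply]
    exact (norm_sub_le _ _).trans (by linarith)
  obtain ⟨C, hC⟩ : ∃ C, ∀ n, ‖fseq n - f‖ ≤ C := by
    obtain ⟨C, hC⟩ := hf0.bddAbove_range
    exact ⟨C, fun n => hC ⟨n, rfl⟩⟩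
  have hbound : ∀ n, ‖gseq n - g₀‖ ≤ C + 2 := by
    intro n
    rw [← HardyBEP.cut_add_cut_compl hImeas (gseq n - g₀)]
    refine (norm_add_le _ _).trans (add_le_add ((hcutle n).trans (hC n)) ?_)
    -- Two candidates differ by at most `2` on `J`, and the total mass is `1`.
    refine (Lp.norm_le_of_ae_bound (C := 2) (by norm_num) ?_).trans (by simp [measureUnivNNReal])
    have h1 := hbd n
    rw [ae_restrict_iff'₀ hImeas.compl] at h1
    filter_upwards [h1, HardyBEP.coeFn_cut hImeas.compl (gseq n - g₀)] with x h2 h3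
    rw [h3]
    by_cases hx : x ∈ Iᶜ
    · rw [Set.indicator_of_mem hx]
      exact h2 hx
    · rw [Set.indicator_of_notMem hx, norm_zero]
      norm_num
  have hweak : ∀ φ : HardyBEP.L2Circle, Tendsto (fun n => inner ℂ φ (gseq n - g₀)) atTop (𝓝 0) :=
    HardyBEP.tendsto_inner_of_tendsto_cut hImeas hI
      (fun n => sub_mem (hgseq n).1.1 hg₀.1.1) hbound hcut
  have hLinf : ∀ g ∈ HardyBEP.candidates I, MemLp (fun x => g x) ∞ (HardyBEP.ell.restrict Iᶜ) :=
    fun g hg => memLp_top_of_bound (Lp.memLp g).aestronglyMeasurable.restrict 1 hg.2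
  refine ⟨tendsto_iff_norm_sub_tendsto_zero.2 (squeeze_zero (fun _ => norm_nonneg _) hlip hf0),
    ⟨fun n => hLinf _ (hgseq n).1, hLinf _ hg₀.1, fun φ hφ => ?_⟩, fun hfr hnot => ?_⟩
  · have h1 := HardyBEP.tendsto_setIntegral_mul hImeas.compl hweak hbd hφ
    have hint : ∀ g ∈ HardyBEP.candidates I, IntegrableOn (fun x => g x * φ x) Iᶜ HardyBEP.ell :=
      fun g hg => Integrable.bdd_mul hφ (Lp.memLp g).aestronglyMeasurable.restrict hg.2
    rw [← tendsto_sub_nhds_zero_iff]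
    refine h1.congr fun n => ?_
    rw [← integral_sub (hint _ (hgseq n).1) (hint _ hg₀.1)]
    refine integral_congr_ae ?_
    filter_upwards [ae_restrict_of_ae (Lp.coeFn_sub (gseq n) g₀)] with x hx
    rw [hx, Pi.sub_apply, sub_mul]
  · have hone := hg₀.one_le_norm hImeas hfr hnot
    -- Off `I`, saturation gives `|gseq n| ≤ 1 ≤ |g₀|` almost everywhere.
    have hle : ∀ n, ‖HardyBEP.cut Iᶜ hImeas.compl (gseq n)‖ ≤
        ‖HardyBEP.cut Iᶜ hImeas.compl g₀‖ := by
      intro n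
      refine Lp.norm_le_norm_of_ae_le ?_
      have h1 := (hgseq n).1.2
      rw [ae_restrict_iff'₀ hImeas.compl] at h1
      filter_upwards [hone, h1, HardyBEP.coeFn_cut hImeas.compl (gseq n),
        HardyBEP.coeFn_cut hImeas.compl g₀] with x h2 h3 h4 h5
      rw [h4, h5]
      by_cases hx : x ∈ Iᶜ
      · rw [Set.indicator_of_mem hx, Set.indicator_of_mem hx]
        exact (h3 hx).trans (h2 hx)
      · rw [Set.indicator_of_notMem hx, Set.indicator_of_notMem hx]
    have hcompl : Tendsto (fun n => HardyBEP.cut Iᶜ hImeas.compl (gseq n - g₀)) atTop (𝓝 0) := by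
      simp only [map_sub]
      refine HardyBEP.tendsto_zero_of_norm_le_of_inner hle
        ((hweak (HardyBEP.cut Iᶜ hImeas.compl g₀)).congr fun n => ?_)
      rw [← map_sub, ← HardyBEP.inner_cut_left, HardyBEP.cut_cut]
    rw [← tendsto_sub_nhds_zero_iff]
    have h1 := hcut.add hcompl
    rw [add_zero] at h1
    exact h1.congr fun n => HardyBEP.cut_add_cut_compl hImeas _
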